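/- **Setting.** Fix an observation $y$. Let $\mathcal G=(V,F,E)$ be a finite factor graph (bipartite between variables $i\in V$ and factors $k\in F\neq\emptyset$) that is a tree; $\partial$ denotes neighbours and $n_i=|\partial i|$. Each $x_i$ ranges over $\mathbb R^{N_i}$; each factor $f_k=f_k(\cdot\,;y_k)$ is a nonzero $\sigma$-finite measure in $x_k=(x_i)_{i\in\partial k}$ (Dirac factors are allowed); $\phi_i:\mathbb R^{N_i}\to\mathbb R^{d_i}$ are measurable sufficient statistics, minimal with respect to Lebesgue measure ($\langle a,\phi_i\rangle$ a.e. constant only for $a=0$). For $\lambda_k=(\lambda_{i\to k})_{i\in\partial k}$ put $\langle\lambda_k,\phi_k(x_k)\rangle=\sum_{i\in\partial k}\langle\lambda_{i\to k},\phi_i(x_i)\rangle$ and $$A_i[\lambda_i]=\ln\int e^{\langle\lambda_i,\phi_i(x_i)\rangle}dx_i,\qquad A_k[\lambda_k]=\ln\int e^{\langle\lambda_k,\phi_k(x_k)\rangle}f_k(dx_k;y_k),$$ on the sets $\Omega_i,\Omega_k$ of parameters where the integrals are finite. Let $p_i(\cdot|\lambda_i)\propto e^{\langle\lambda_i,\phi_i\rangle}dx_i$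 and $p_k(\cdot|\lambda_k)\propto e^{\langle\lambda_k,\phi_k\rangle}f_k$, let $\mu_i[\lambda_i]$ and $\mu_k[\lambda_k]=(\mu_i^k[\lambda_k])_{i\in\partial k}$ be the means of $\phi_i$ under them, and let $G_i[\mu_i]=\sup_{\lambda_i\in\Omega_i}\langle\lambda_i,\mu_i\rangle-A_i[\lambda_i]$, $G_k[\mu_k]=\sup_{\lambda_k\in\Omega_k}\langle\lambda_k,\mu_k\rangle-A_k[\lambda_k]$. The EC Gibbs, EP and Tree-AMP free energies are $$G[\mu_V]=\sum_{k\in F}G_k[\mu_k]+\sum_{i\in V}(1-n_i)G_i[\mu_i],\quad \mu_k=(\mu_i)_{i\in\partial k},$$ $$A[\lambda_V,\lambda_F]=\sum_{k\in F}A_k[\lambda_k]+\sum_{i\in V}(1-n_i)A_i[\lambda_i],$$ $$A[\lambda_E]=\sum_{k\in F}A_k[\lambda_k]-\sum_{(i,k)\in E}A_i[\lambda_i^k]+\sum_{i\in V}A_i[\lambda_i],\quad \lambda_k=(\lambda_{i\to k})_{i\in\partial k},\ \lambda_i^k=\lambda_{i\to k}+\lambda_{k\to i},\ \lambda_i=\sum_{k\in\partial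 i}\lambda_{k\to i}.$$ $G$ is considered on the $\mu_V$ with all $G_k[\mu_k]<\infty$. Call $\mu_V$ *regular* if $\mu_i=\mu_i[\lambda_i]$ and $\mu_k=\mu_k[\lambda_k]$ for some $\lambda_i,\lambda_k$ interior to $\Omega_i,\Omega_k$, for all $i,k$. **Relaxed Bethe problem.** Collections $(p_V,p_F)$ of probability measures $p_i\ll dx_i$, $p_k\ll f_k$, with integrable log-densities and statistics, have Bethe free energy $\mathcal F[p_V,p_F]=\sum_k\mathrm{KL}[p_k\|f_k]+\sum_i(1-n_i)(-\mathrm H[p_i])$. They are weakly consistent with moments $\mu_V$ if $\mathbb E_{p_i}\phi_i=\mathbb E_{p_k}\phi_i=\mu_i$ for all $(i,k)\in E$. A solution at fixed moments $\mu_V$ is a weakly consistent collection with moments $\mu_V$ that is a stationary point of the Lagrangian $$\mathcal F+\sum_{(i,k)\in E}\langle\lambda_{i\to k},\mu_i-\mathbb E_{p_k}\phi_i\rangle+\sum_{i\in V}(1-n_i)\langle\lambda_i,\mu_i-\mathbb E_{p_i}\phi_i\rangle$$ for some multipliers (its derivative vanishes along the segment to every other admissible collection). $F_\phi(y)$ is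 the least value of $\mathcal F$ at a solution, over all $\mu_V$. **Claim.** 1. There is a solution at every regular $\mu_V$. Every solution at any moments $\mu_V$ has $\mathcal F[p_V,p_F]=G[\mu_V]$, and among the admissible collections with moments $\mu_V$ it minimizes $\mathcal F$ over $p_F$ (at fixed $p_V$) and maximizes it over $p_V$ (at fixed $p_F$). 2. If $G$ attains its minimum, at a regular point, then $$F_\phi(y)=\min_{\mu_V}G[\mu_V]=\min_{\lambda_V}\max_{\lambda_F}-A[\lambda_V,\lambda_F]\ \text{ s.t. }\ \forall i:\ (n_i-1)\lambda_i=\sum_{k\in\partial i}\lambda_{i\to k}\ =\ \min\operatorname{extr}_{\lambda_E}-A[\lambda_E].$$ All extrema are attained (the inner maximum for every $\lambda_V\in\prod_i\Omega_i$), with $\lambda_F\in\prod_k\Omega_k$; $\min\operatorname{extr}$ is the value of $-A[\lambda_E]$ at any stationary point of $A[\lambda_E]$ whose moments $(\mu_i[\lambda_i])_i$ minimize $G$ among all stationary points. 3. Any stationary point of the free energies is an EP fixed point: $\mu_i=\mu_i^k$ for all $(i,k)\in E$ and $(n_i-1)\lambda_i=\sum_{k\in\partial i}\lambda_{i\to k}$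 for all $i$. Precisely, with parameters interior to $\Omega_i,\Omega_k$: (a) if $\mu_V$ is regular and stationary for $G$ (along the domain of $G$), there are $\lambda_V,\lambda_F$ with $\mu_i=\mu_i[\lambda_i]=\mu_i^k[\lambda_k]$ and the natural-parameter constraint; (b) if $(\lambda_V,\lambda_F)$ is stationary for $A[\lambda_V,\lambda_F]$ under the natural-parameter constraint, there is $\mu_V$ with $\mu_i^k[\lambda_k]=\mu_i$ for all $(i,k)\in E$ and $\mu_i[\lambda_i]=\mu_i$ for all $i$ with $n_i\neq1$ (for $n_i=1$ neither $A$ nor the constraint depends on $\lambda_i$); (c) if $\lambda_E$ is stationary for $A[\lambda_E]$, then $\mu_i[\lambda_i]=\mu_i^k[\lambda_k]$ and the natural-parameter constraint hold. -/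

import Mathlib

open MeasureTheory Set

noncomputable section

/-- The bipartite graph on variable nodes `V` and factor nodes `F` in which `i` and `k` are joined
iff `i ∈ nbr k`, that is, iff the variable `i` is an argument of the factor `k`. -/
def factorGraph {V F : Type*} (nbr : F → Finset V) : SimpleGraph (V ⊕ F) :=
  SimpleGraph.fromRel fun a b =>
    match a, b with
    | .inl i, .inr k => i ∈ nbr k
    | _, _ => False

/-- A tree-structured model (at a fixed observation `y`) with sufficient statistics.
The variable `x i` lives in `ℝ ^ N i`, the factor `f k` is a (generic, not necessarily finite or
absolutely continuous) measure `f_k(dx_k; y_k)` in its arguments `x_k = (x_i)_{i ∈ nbr k}`, and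
`φ i : ℝ ^ N i → ℝ ^ d i` is the sufficient statistic chosen for the variable `i`. -/
structure TreeModel (V F : Type*) where
  nbr : F → Finset V
  isTree : (factorGraph nbr).IsTree
  N : V → ℕ
  d : V → ℕ
  φ : ∀ i, EuclideanSpace ℝ (Fin (N i)) → EuclideanSpace ℝ (Fin (d i))
  measurable_φ : ∀ i, Measurable (φ i)
  f : ∀ k, Measure (∀ i : nbr k, EuclideanSpace ℝ (Fin (N i)))
  sigmaFinite_f : ∀ k, SigmaFinite (f k)
  f_ne_zero : ∀ k, f k ≠ 0

namespace TreeModel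

variable {V F : Type*} (M : TreeModel V F)

/-- The space of the variable `x_i`. -/
abbrev X (i : V) : Type := EuclideanSpace ℝ (Fin (M.N i))

/-- The space of natural parameters and of moments of the variable `i`. -/
abbrev P (i : V) : Type := EuclideanSpace ℝ (Fin (M.d i))

/-- The space of the arguments `x_k = (x_i)_{i ∈ ∂k}` of the factor `k`. -/
abbrev XF (k : F) : Type _ := ∀ i : M.nbr k, M.X i

/-- The space of natural parameters `(lam_{i → k})_{i ∈ ∂k}` and of moments of the factor `k`. -/
abbrev PF (k : F) : Type _ := ∀ i : M.nbr k, M.P i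

/-- Collections indexed by the variables: `lam_V` or `mu_V`. -/
abbrev VarParams : Type _ := ∀ i, M.P i

/-- Collections indexed by the edges, grouped by factors: `lam_F = (lam_{i → k})`. -/
abbrev FacParams : Type _ := ∀ k, M.PF k

/-- The number `n_i` of factors neighbouring the variable `i`. -/
def n [DecidableEq V] [Fintype F] (i : V) : ℕ := Fintype.card {k : F // i ∈ M.nbr k}

/-- The moments `mu_k = (mu_i)_{i ∈ ∂k}`. -/
def restrict (mu : M.VarParams) (k : F) : M.PF k := fun i => mu i

/-! ### Exponential families -/

/-- `⟨lam_i, φ_i(x_i)⟩`. -/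
def varEnergy (i : V) (lam : M.P i) (x : M.X i) : ℝ := inner ℝ lam (M.φ i x)

/-- `⟨lam_k, φ_k(x_k)⟩ = ∑_{i ∈ ∂k} ⟨lam_{i → k}, φ_i(x_i)⟩`. -/
def facEnergy (k : F) (lam : M.PF k) (x : M.XF k) : ℝ :=
  ∑ i : M.nbr k, inner ℝ (lam i) (M.φ i (x i))

/-- Natural parameters of the variable family: those with finite partition function. -/
def varDomain (i : V) : Set (M.P i) :=
  {lam | Integrable (fun x => Real.exp (M.varEnergy i lam x)) volume}

/-- Natural parameters of the factor family: those with finite partition function. -/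
def facDomain (k : F) : Set (M.PF k) :=
  {lam | Integrable (fun x => Real.exp (M.facEnergy k lam x)) (M.f k)}

/-- The variable log-partition `A_i`. -/
def varLogPartition (i : V) (lam : M.P i) : ℝ :=
  Real.log (∫ x, Real.exp (M.varEnergy i lam x))

/-- The factor log-partition `A_k`. -/
def facLogPartition (k : F) (lam : M.PF k) : ℝ :=
  Real.log (∫ x, Real.exp (M.facEnergy k lam x) ∂(M.f k))

/-- The exponential family `p_i(x_i | lam_i)`, with base measure the Lebesgue measure. -/
def varMarginal (i : V) (lam : M.P i) : Measure (M.X i) :=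
  (volume : Measure (M.X i)).tilted (M.varEnergy i lam)

/-- The exponential family `p_k(x_k | lam_k)`, with base measure the factor `f_k`. -/
def facMarginal (k : F) (lam : M.PF k) : Measure (M.XF k) :=
  (M.f k).tilted (M.facEnergy k lam)

/-- The moment `mu_i[lam_i]`. -/
def varMoment (i : V) (lam : M.P i) : M.P i := ∫ x, M.φ i x ∂(M.varMarginal i lam)

/-- The moments `mu_k[lam_k] = (mu_i^k[lam_k])_{i ∈ ∂k}`. -/
def facMoment (k : F) (lam : M.PF k) : M.PF k := fun i =>
  ∫ x, M.φ i (x i) ∂(M.facMarginal k lam)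

/-- The variable families are minimal: no nontrivial linear combination of the coordinates of
`φ_i` is constant almost everywhere. -/
def VariableMinimal : Prop :=
  ∀ (i : V) (a : M.P i) (c : ℝ), (∀ᵐ x : M.X i, inner ℝ a (M.φ i x) = c) → a = 0

/-- The Legendre transform `G_i` of `A_i`. -/
def varGibbs (i : V) (m : M.P i) : EReal :=
  ⨆ lam ∈ M.varDomain i, ((inner ℝ lam m - M.varLogPartition i lam : ℝ) : EReal)

/-- The Legendre transform `G_k` of `A_k`. -/
def facGibbs (k : F) (m : M.PF k) : EReal :=
  ⨆ lam ∈ M.facDomain k,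
    (((∑ i : M.nbr k, inner ℝ (lam i) (m i)) - M.facLogPartition k lam : ℝ) : EReal)

/-! ### The relaxed Bethe variational problem -/

/-- A collection of candidate marginals `(p_V, p_F)`. -/
structure Beliefs where
  pV : ∀ i, Measure (M.X i)
  pF : ∀ k, Measure (M.XF k)

/-- `KL[p ‖ ν] = ∫ log (dp/dν) dp`, where `ν` need not be normalized. For `ν` the Lebesgue measure
this is the negative entropy `-H[p]`. -/
def relEnt {α : Type*} [MeasurableSpace α] (p ν : Measure α) : ℝ := ∫ x, llr p ν x ∂p

/-- The beliefs are probability measures at which all terms of the Bethe free energy and all the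
moments are well defined and finite. -/
structure Beliefs.Admissible {M : TreeModel V F} (b : M.Beliefs) : Prop where
  prob_V : ∀ i, IsProbabilityMeasure (b.pV i)
  prob_F : ∀ k, IsProbabilityMeasure (b.pF k)
  ac_V : ∀ i, b.pV i ≪ volume
  ac_F : ∀ k, b.pF k ≪ M.f k
  integrable_llr_V : ∀ i, Integrable (llr (b.pV i) volume) (b.pV i)
  integrable_llr_F : ∀ k, Integrable (llr (b.pF k) (M.f k)) (b.pF k)
  integrable_φ_V : ∀ i, Integrable (M.φ i) (b.pV i)
  integrable_φ_F : ∀ k, ∀ i : M.nbr k, Integrable (fun x : M.XF k => M.φ i (x i)) (b.pF k)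

/-- `E_{p_i} φ_i(x_i)`. -/
def Beliefs.momentV {M : TreeModel V F} (b : M.Beliefs) (i : V) : M.P i :=
  ∫ x, M.φ i x ∂(b.pV i)

/-- `E_{p_k} φ_i(x_i)` for `i ∈ ∂k`. -/
def Beliefs.momentF {M : TreeModel V F} (b : M.Beliefs) (k : F) : M.PF k := fun i =>
  ∫ x, M.φ i (x i) ∂(b.pF k)

/-- Moment matching at the moments `mu`: for every edge `(i, k)` the beliefs `p_i` and `p_k` both
give `φ_i(x_i)` the expectation `mu_i`. The beliefs for which this holds for some `mu` are the
weakly consistent ones. -/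
def Beliefs.HasMoments {M : TreeModel V F} (b : M.Beliefs) (mu : M.VarParams) : Prop :=
  (∀ i, b.momentV i = mu i) ∧ ∀ k, b.momentF k = M.restrict mu k

/-- The mixture `(1 - t) b + t b'` of two collections of beliefs. -/
def Beliefs.mix {M : TreeModel V F} (b b' : M.Beliefs) (t : ℝ) : M.Beliefs where
  pV i := ENNReal.ofReal (1 - t) • b.pV i + ENNReal.ofReal t • b'.pV i
  pF k := ENNReal.ofReal (1 - t) • b.pF k + ENNReal.ofReal t • b'.pF k

variable [Fintype V] [DecidableEq V] [Fintype F]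

/-- The Bethe free energy. -/
def betheFreeEnergy (b : M.Beliefs) : ℝ :=
  ∑ k, relEnt (b.pF k) (M.f k) + ∑ i, (1 - (M.n i : ℝ)) * relEnt (b.pV i) volume

/-- The Lagrangian of the minimization of the Bethe free energy at fixed moments `mu`, with
multipliers `lamV`, `lamF`. -/
def betheLagrangian (mu lamV : M.VarParams) (lamF : M.FacParams) (b : M.Beliefs) : ℝ :=
  M.betheFreeEnergy b
    + ∑ k, ∑ i : M.nbr k, inner ℝ (lamF k i) (mu i - b.momentF k i)
    + ∑ i, (1 - (M.n i : ℝ)) * inner ℝ (lamV i) (mu i - b.momentV i)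

/-- `b` solves the Bethe problem at fixed moments `mu`: it is a stationary point of the Lagrangian.
It satisfies the moment constraints (stationarity in the multipliers), and for suitable multipliers
the variation of the Lagrangian at `b` vanishes towards any other admissible beliefs. -/
def IsBetheStationaryAt (mu : M.VarParams) (b : M.Beliefs) : Prop :=
  b.Admissible ∧ b.HasMoments mu ∧
    ∃ (lamV : M.VarParams) (lamF : M.FacParams), ∀ b' : M.Beliefs, b'.Admissible →
      HasDerivWithinAt (fun t => M.betheLagrangian mu lamV lamF (b.mix b' t)) 0 (Ici 0) 0

/-- The values of the relaxed Bethe problem: the Bethe free energies of its solutions at fixed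
moments, for all possible values of the moments. The optimal value `F_φ(y)` is the least one. -/
def relaxedBetheValues : Set ℝ :=
  {v | ∃ mu b, M.IsBetheStationaryAt mu b ∧ M.betheFreeEnergy b = v}

/-! ### The EC Gibbs free energy -/

/-- The EC Gibbs free energy `G[mu_V]`. -/
def gibbsFreeEnergy (mu : M.VarParams) : EReal :=
  ∑ k, M.facGibbs k (M.restrict mu k)
    + ∑ i, ((1 - (M.n i : ℝ) : ℝ) : EReal) * M.varGibbs i (mu i)

/-- The moments at which `G` is considered: those at which all the factor terms `G_k` are finite. -/
def gibbsDomain : Set M.VarParams := {mu | ∀ k, M.facGibbs k (M.restrict mu k) ≠ ⊤}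

/-- The moments to which the duality with natural parameters applies: `mu_i = mu_i[lam_i]` and
`mu_k = mu_k[lam_k]` for some natural parameters in the interior of the respective domains. -/
def momentDomain : Set M.VarParams :=
  {mu | (∀ i, ∃ lam ∈ interior (M.varDomain i), M.varMoment i lam = mu i) ∧
    ∀ k, ∃ lam ∈ interior (M.facDomain k), M.facMoment k lam = M.restrict mu k}

/-- `c` is the minimum of the EC Gibbs free energy, attained where moments and natural parameters
are dual to each other. -/
def IsGibbsMinimum (c : ℝ) : Prop :=
  ∃ mu ∈ M.momentDomain, M.gibbsFreeEnergy mu = (c : EReal) ∧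
    ∀ mu' ∈ M.gibbsDomain, (c : EReal) ≤ M.gibbsFreeEnergy mu'

/-- Stationary points of the EC Gibbs free energy, the derivative being taken along the domain. -/
def IsGibbsStationary (mu : M.VarParams) : Prop :=
  mu ∈ M.momentDomain ∧
    HasFDerivWithinAt (fun m => (M.gibbsFreeEnergy m).toReal)
      (0 : M.VarParams →L[ℝ] ℝ) M.gibbsDomain mu

/-! ### The EP free energy -/

/-- The EP free energy `A[lam_V, lam_F]`. -/
def epFreeEnergy (lamV : M.VarParams) (lamF : M.FacParams) : ℝ :=
  ∑ k, M.facLogPartition k (lamF k) + ∑ i, (1 - (M.n i : ℝ)) * M.varLogPartition i (lamV i)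

/-- `(n_i - 1) lam_i = ∑_{k ∈ ∂i} lam_{i → k}` for all variables `i`. -/
def NaturalConstraint (lamV : M.VarParams) (lamF : M.FacParams) : Prop :=
  ∀ i, ((M.n i : ℝ) - 1) • lamV i = ∑ k : {k : F // i ∈ M.nbr k}, lamF k ⟨i, k.2⟩

/-- The factor natural parameters over which one maximizes at given `lam_V`. -/
def epFeasible (lamV : M.VarParams) : Set M.FacParams :=
  {lamF | (∀ k, lamF k ∈ M.facDomain k) ∧ M.NaturalConstraint lamV lamF}

/-- The values `max_{lam_F} - A[lam_V, lam_F]` under the constraint, for all `lam_V`. -/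
def epMaxValues : Set ℝ :=
  {v | ∃ lamV, (∀ i, lamV i ∈ M.varDomain i) ∧
    IsGreatest ((fun lamF => - M.epFreeEnergy lamV lamF) '' M.epFeasible lamV) v}

/-- Stationary points of the EP free energy under the constraint. -/
def IsEPStationary (lamV : M.VarParams) (lamF : M.FacParams) : Prop :=
  (∀ i, lamV i ∈ interior (M.varDomain i)) ∧ (∀ k, lamF k ∈ interior (M.facDomain k)) ∧
    M.NaturalConstraint lamV lamF ∧
    HasFDerivWithinAt (fun q : M.VarParams × M.FacParams => M.epFreeEnergy q.1 q.2)
      (0 : M.VarParams × M.FacParams →L[ℝ] ℝ) {q | M.NaturalConstraint q.1 q.2} (lamV, lamF)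

/-! ### The Tree-AMP free energy -/

/-- The messages `lam_E`: the factor-to-variable messages `lam_{k → i}` (first component) and the
variable-to-factor messages `lam_{i → k}` (second component), over all edges. -/
abbrev Messages : Type _ := M.FacParams × M.FacParams

/-- `lam_i = ∑_{k ∈ ∂i} lam_{k → i}`. -/
def msgVar (lamE : M.Messages) : M.VarParams := fun i =>
  ∑ k : {k : F // i ∈ M.nbr k}, lamE.1 k ⟨i, k.2⟩

/-- `lam_k = (lam_{i → k})_{i ∈ ∂k}`. -/
def msgFac (lamE : M.Messages) : M.FacParams := lamE.2

/-- `lam_i^k = lam_{i → k} + lam_{k → i}`. -/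
def msgEdge (lamE : M.Messages) (k : F) (i : M.nbr k) : M.P i := lamE.2 k i + lamE.1 k i

/-- The Tree-AMP free energy `A[lam_E]`. -/
def treeAMPFreeEnergy (lamE : M.Messages) : ℝ :=
  ∑ k, M.facLogPartition k (M.msgFac lamE k)
    - ∑ k, ∑ i : M.nbr k, M.varLogPartition i (M.msgEdge lamE k i)
    + ∑ i, M.varLogPartition i (M.msgVar lamE i)

/-- (Unconstrained) stationary points of the Tree-AMP free energy. -/
def IsTreeAMPStationary (lamE : M.Messages) : Prop :=
  (∀ k, M.msgFac lamE k ∈ interior (M.facDomain k)) ∧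
    (∀ k, ∀ i : M.nbr k, M.msgEdge lamE k i ∈ interior (M.varDomain i)) ∧
    (∀ i, M.msgVar lamE i ∈ interior (M.varDomain i)) ∧
    HasFDerivAt M.treeAMPFreeEnergy (0 : M.Messages →L[ℝ] ℝ) lamE

/-- The moments `mu_i[lam_i]` of the messages. -/
def msgMoment (lamE : M.Messages) : M.VarParams := fun i => M.varMoment i (M.msgVar lamE i)

/-- `v` is a value of `min extr - A[lam_E]`: the value of `- A` at a stationary point whose moments
minimize `G` among all stationary points. -/
def IsMinExtr (v : ℝ) : Prop :=
  ∃ lamE, M.IsTreeAMPStationary lamE ∧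
    (∀ lamE', M.IsTreeAMPStationary lamE' →
      M.gibbsFreeEnergy (M.msgMoment lamE) ≤ M.gibbsFreeEnergy (M.msgMoment lamE')) ∧
    v = - M.treeAMPFreeEnergy lamE

/-! ### EP fixed points -/

/-- EP fixed points: the moment matching `mu_i = mu_i^k` on every edge, together with
`(n_i - 1) lam_i = ∑_{k ∈ ∂i} lam_{i → k}`. -/
def IsEPFixedPoint (lamV : M.VarParams) (lamF : M.FacParams) : Prop :=
  (∀ i, lamV i ∈ interior (M.varDomain i)) ∧ (∀ k, lamF k ∈ interior (M.facDomain k)) ∧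
    (∀ k, ∀ i : M.nbr k, M.varMoment i (lamV i) = M.facMoment k (lamF k) i) ∧
    M.NaturalConstraint lamV lamF

end TreeModel

end

/-!
Every object in the statement is built from exponential families `p ∝ e^{T lam} ν`, one for each
variable and one for each factor, so the analysis is carried out once, in `ExpFamily`, for a
`σ`-finite base measure `ν` and a statistic `T` with values in the dual of the parameter space.
Minimality is not assumed there: a factor may be degenerate, and `ExpFamily.flat` is the subspace of
directions along which the energy is almost everywhere constant.

Three facts about one family carry the proof. Let `A` be its log-partition function.
* `A` is convex with closed sublevel sets. At an interior parameter it is differentiable, its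
  derivative is the mean, and its Bregman divergence grows linearly transversally to `flat`
  (`exists_coercive`). Dually, the Legendre transform of `A` at a mean has the natural parameter as
  its derivative, in the directions that annihilate `flat` (`hasDerivAt_legendre`).
* The relative entropy satisfies the Gibbs variational inequality, and the members of the family are
  stationary for the entropic Lagrangian (`hasDerivWithinAt_lagrangian_tilted`).
* Conversely, by convexity a stationary point of that Lagrangian is a minimizer; comparing it with
  truncations of the exponential family shows that the multiplier lies in the domain of `A` and that
  the Gibbs inequality is an equality (`IsAdmissible.relEnt_eq_of_stationary`).

The last two facts solve the relaxed Bethe problem at fixed moments: its value is the sum of the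
Legendre transforms, and the saddle property follows from the signs of the coefficients `1 - n_i`,
where `n_i ≥ 1` because the factor graph is connected and has a factor.

At a regular point of vanishing derivative of `G`, the defect in the natural-parameter constraint
annihilates all directions in which the factor moments can move. It is therefore a sum of flat
directions of the factors, by which the factor parameters may be shifted without changing anything
else (`exists_fixedPoint_of_deriv_eq_zero`); this gives an EP fixed point. For the free energies in
the natural parameters, one differentiates along single edges; in the Tree-AMP case the injectivity
of the mean maps of the variables then identifies the natural parameters.

The inner maximum over the factor parameters is an infimal convolution of convex functions. By
coercivity its epigraph is closed (`isClosed_convEpigraph`), which gives attainment, and a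
separation argument gives strong duality (`mem_convEpigraph_of_dual_bound`): a lower bound on `G` is
also a lower bound on the inner maximum. Equality holds at the EP fixed point of a minimizer of `G`,
and this fixed point is also a stationary point of the Tree-AMP free energy with the same value.
-/

/-! ### Exponential families -/

noncomputable section

namespace ExpFamily

variable {α : Type*} [MeasurableSpace α] {E : Type*} [NormedAddCommGroup E] [NormedSpace ℝ E]

/-- Natural parameters of the exponential family with base measure `ν` and sufficient statistic `T`.
The statistic takes values in the dual of the parameter space, so that `T x lam` is the energy. -/
def domain (ν : Measure α) (T : α → StrongDual ℝ E) : Set E :=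
  {lam | Integrable (fun x => Real.exp (T x lam)) ν}

/-- The log-partition function. -/
def logPartition (ν : Measure α) (T : α → StrongDual ℝ E) (lam : E) : ℝ :=
  Real.log (∫ x, Real.exp (T x lam) ∂ν)

/-- The mean of the sufficient statistic under the member of the family with parameter `lam`. -/
def mean (ν : Measure α) (T : α → StrongDual ℝ E) (lam : E) : StrongDual ℝ E :=
  ∫ x, T x ∂(ν.tilted fun x => T x lam)

/-- The Legendre transform of the log-partition function, restricted to its domain. -/
def legendre (ν : Measure α) (T : α → StrongDual ℝ E) (m : StrongDual ℝ E) : EReal :=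
  ⨆ lam ∈ domain ν T, ((m lam - logPartition ν T lam : ℝ) : EReal)

/-- The directions in which the energy is almost everywhere constant. The family is minimal iff
this subspace is trivial; in general it is the kernel of the parametrization. -/
def flat (ν : Measure α) (T : α → StrongDual ℝ E) : Submodule ℝ E where
  carrier := {a | ∃ c : ℝ, ∀ᵐ x ∂ν, T x a = c}
  zero_mem' := ⟨0, by simp⟩
  add_mem' := by
    rintro a b ⟨c, hc⟩ ⟨c', hc'⟩
    refine ⟨c + c', ?_⟩
    filter_upwards [hc, hc'] with x h h'
    simp [h, h']
  smul_mem' := by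
    rintro r a ⟨c, hc⟩
    refine ⟨r * c, ?_⟩
    filter_upwards [hc] with x h
    simp [h]

variable {ν : Measure α} {T : α → StrongDual ℝ E}

theorem mem_domain {lam : E} :
    lam ∈ domain ν T ↔ Integrable (fun x => Real.exp (T x lam)) ν := Iff.rfl

theorem partition_pos [NeZero ν] {lam : E} (h : lam ∈ domain ν T) :
    0 < ∫ x, Real.exp (T x lam) ∂ν := integral_exp_pos h

theorem exp_logPartition [NeZero ν] {lam : E} (h : lam ∈ domain ν T) :
    Real.exp (logPartition ν T lam) = ∫ x, Real.exp (T x lam) ∂ν :=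
  Real.exp_log (partition_pos h)

theorem isProbabilityMeasure_tilted [NeZero ν] {lam : E} (h : lam ∈ domain ν T) :
    IsProbabilityMeasure (ν.tilted fun x => T x lam) :=
  MeasureTheory.isProbabilityMeasure_tilted h

theorem le_legendre {lam : E} (h : lam ∈ domain ν T) (m : StrongDual ℝ E) :
    ((m lam - logPartition ν T lam : ℝ) : EReal) ≤ legendre ν T m :=
  le_iSup₂ (f := fun lam (_ : lam ∈ domain ν T) =>
    ((m lam - logPartition ν T lam : ℝ) : EReal)) lam h

theorem legendre_le_iff {m : StrongDual ℝ E} {c : ℝ} :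
    legendre ν T m ≤ (c : EReal) ↔ ∀ lam ∈ domain ν T, m lam - logPartition ν T lam ≤ c := by
  simp only [legendre, iSup_le_iff, EReal.coe_le_coe_iff]

theorem coe_toReal_legendre {m : StrongDual ℝ E} (hne : (domain ν T).Nonempty)
    (h : legendre ν T m ≠ ⊤) : (((legendre ν T m).toReal : ℝ) : EReal) = legendre ν T m := by
  obtain ⟨lam, hlam⟩ := hne
  refine EReal.coe_toReal h fun hb => ?_
  have := le_legendre hlam m
  rw [hb] at this
  exact absurd (le_bot_iff.1 this) (EReal.coe_ne_bot _)

section Convexity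

/-- The log-partition function is convex, with convex domain. -/
theorem logPartition_combo [NeZero ν] (hT : ∀ l, Measurable fun x => T x l) {a b : E} {s t : ℝ}
    (ha : a ∈ domain ν T) (hb : b ∈ domain ν T) (hs : 0 ≤ s) (ht : 0 ≤ t) (hst : s + t = 1) :
    s • a + t • b ∈ domain ν T ∧
      logPartition ν T (s • a + t • b) ≤ s * logPartition ν T a + t * logPartition ν T b := by
  set A := logPartition ν T a
  set B := logPartition ν T b
  have hpt : ∀ x, Real.exp (-(s * A + t * B)) * Real.exp (T x (s • a + t • b)) ≤
      s * (Real.exp (-A) * Real.exp (T x a)) + t * (Real.exp (-B) * Real.exp (T x b)) := by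
    intro x
    have := convexOn_exp.2 (mem_univ (T x a - A)) (mem_univ (T x b - B)) hs ht hst
    simp only [smul_eq_mul] at this
    rw [← Real.exp_add, ← Real.exp_add, ← Real.exp_add]
    have e1 : -(s * A + t * B) + T x (s • a + t • b) = s * (T x a - A) + t * (T x b - B) := by
      simp only [map_add, map_smul, smul_eq_mul]; ring
    rwa [e1, neg_add_eq_sub, neg_add_eq_sub]
  have hint : Integrable (fun x => s * (Real.exp (-A) * Real.exp (T x a)) +
      t * (Real.exp (-B) * Real.exp (T x b))) ν :=
    ((ha.const_mul _).const_mul _).add ((hb.const_mul _).const_mul _)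
  have hdom' : Integrable (fun x => Real.exp (-(s * A + t * B)) *
      Real.exp (T x (s • a + t • b))) ν := by
    refine hint.mono' ((hT _).exp.const_mul _).aestronglyMeasurable (ae_of_all _ fun x => ?_)
    rw [Real.norm_of_nonneg (by positivity)]
    exact hpt x
  have hdom : s • a + t • b ∈ domain ν T := by
    have := hdom'.const_mul (Real.exp (s * A + t * B))
    refine this.congr (ae_of_all _ fun x => ?_)
    simp only [← Real.exp_add]
    rw [add_neg_cancel_left]
  refine ⟨hdom, ?_⟩
  have h1 := integral_mono hdom' hint hpt
  rw [integral_add ((ha.const_mul _).const_mul _) ((hb.const_mul _).const_mul _)] at h1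
  simp only [integral_const_mul] at h1
  rw [← exp_logPartition ha, ← exp_logPartition hb, ← exp_logPartition hdom, ← Real.exp_add,
    ← Real.exp_add, ← Real.exp_add] at h1
  simp only [A, B, neg_add_cancel, Real.exp_zero, mul_one, hst] at h1
  rw [Real.exp_le_one_iff] at h1
  linarith

/-- The sublevel sets of the log-partition function are closed, jointly with the level. -/
theorem logPartition_le_of_tendsto [NeZero ν] (hT : ∀ l, Measurable fun x => T x l)
    {u : ℕ → E} {s : ℕ → ℝ} {l : E} {c : ℝ} (hu : ∀ n, u n ∈ domain ν T)
    (hus : ∀ n, logPartition ν T (u n) ≤ s n) (hl : Filter.Tendsto u Filter.atTop (nhds l))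
    (hs : Filter.Tendsto s Filter.atTop (nhds c)) :
    l ∈ domain ν T ∧ logPartition ν T l ≤ c := by
  have key : ∫⁻ x, ENNReal.ofReal (Real.exp (T x l)) ∂ν ≤ ENNReal.ofReal (Real.exp c) := by
    have h1 : ∀ x, Filter.Tendsto (fun n => ENNReal.ofReal (Real.exp (T x (u n)))) Filter.atTop
        (nhds (ENNReal.ofReal (Real.exp (T x l)))) := fun x =>
      (ENNReal.continuous_ofReal.tendsto _).comp
        ((Real.continuous_exp.tendsto _).comp (((T x).continuous.tendsto _).comp hl))
    have h2 : Filter.Tendsto (fun n => ENNReal.ofReal (Real.exp (s n))) Filter.atTop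
        (nhds (ENNReal.ofReal (Real.exp c))) :=
      (ENNReal.continuous_ofReal.tendsto _).comp ((Real.continuous_exp.tendsto _).comp hs)
    calc ∫⁻ x, ENNReal.ofReal (Real.exp (T x l)) ∂ν
        = ∫⁻ x, Filter.liminf (fun n => ENNReal.ofReal (Real.exp (T x (u n)))) Filter.atTop ∂ν :=
          lintegral_congr fun x => (h1 x).liminf_eq.symm
      _ ≤ Filter.liminf (fun n => ∫⁻ x, ENNReal.ofReal (Real.exp (T x (u n))) ∂ν) Filter.atTop :=
          lintegral_liminf_le fun n => (hT _).exp.ennreal_ofReal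
      _ ≤ Filter.liminf (fun n => ENNReal.ofReal (Real.exp (s n))) Filter.atTop := by
          refine Filter.liminf_le_liminf (Filter.Eventually.of_forall fun n => ?_)
          rw [← ofReal_integral_eq_lintegral_ofReal (hu n) (ae_of_all _ fun x => (Real.exp_pos _).le),
            ← exp_logPartition (hu n)]
          exact ENNReal.ofReal_le_ofReal (Real.exp_le_exp.2 (hus n))
      _ = ENNReal.ofReal (Real.exp c) := h2.liminf_eq
  have hdom : l ∈ domain ν T := by
    refine (lintegral_ofReal_ne_top_iff_integrable (hT l).exp.aestronglyMeasurable
      (ae_of_all _ fun x => (Real.exp_pos _).le)).1 (key.trans_lt ENNReal.ofReal_lt_top).ne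
  refine ⟨hdom, ?_⟩
  rw [← ofReal_integral_eq_lintegral_ofReal hdom (ae_of_all _ fun x => (Real.exp_pos _).le),
    ENNReal.ofReal_le_ofReal_iff (Real.exp_pos _).le, ← exp_logPartition hdom] at key
  exact Real.exp_le_exp.1 key

end Convexity

section Flat

theorem add_flat [NeZero ν] {lam a : E} {c : ℝ} (hc : ∀ᵐ x ∂ν, T x a = c)
    (h : lam ∈ domain ν T) :
    lam + a ∈ domain ν T ∧ logPartition ν T (lam + a) = logPartition ν T lam + c := by
  have hae : (fun x => Real.exp c * Real.exp (T x lam)) =ᵐ[ν] fun x => Real.exp (T x (lam + a)) := by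
    filter_upwards [hc] with x hx
    rw [map_add, hx, Real.exp_add, mul_comm]
  have hd : lam + a ∈ domain ν T := (h.const_mul (Real.exp c)).congr hae
  refine ⟨hd, ?_⟩
  apply Real.exp_injective
  rw [exp_logPartition hd, ← integral_congr_ae hae, integral_const_mul, Real.exp_add,
    exp_logPartition h, mul_comm]

theorem domain_add_flat [NeZero ν] {lam a : E} (ha : a ∈ flat ν T) :
    lam + a ∈ domain ν T ↔ lam ∈ domain ν T := by
  refine ⟨fun h => ?_, fun h => ?_⟩
  · obtain ⟨c, hc⟩ := (flat ν T).neg_mem ha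
    simpa using (add_flat hc h).1
  · obtain ⟨c, hc⟩ := ha
    exact (add_flat hc h).1

theorem interior_domain_add_flat [NeZero ν] {lam a : E} (ha : a ∈ flat ν T)
    (h : lam ∈ interior (domain ν T)) : lam + a ∈ interior (domain ν T) := by
  rw [mem_interior_iff_mem_nhds] at h ⊢
  have : Filter.Tendsto (fun l => l - a) (nhds (lam + a)) (nhds lam) := by
    have := (continuous_sub_right a).tendsto (lam + a)
    simpa using this
  filter_upwards [this h] with l hl
  have := (domain_add_flat ha).2 (show l - a ∈ domain ν T from hl)
  simpa using this

theorem tilted_add_flat {lam a : E} {c : ℝ} (hc : ∀ᵐ x ∂ν, T x a = c) :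
    (ν.tilted fun x => T x (lam + a)) = ν.tilted fun x => T x lam := by
  have h1 : (ν.tilted fun x => T x (lam + a)) = ν.tilted fun x => T x lam + c := by
    apply tilted_congr
    filter_upwards [hc] with x hx
    rw [map_add, hx]
  rw [h1]
  simp only [Measure.tilted, Real.exp_add, integral_mul_const]
  congr 1
  ext x
  rw [mul_div_mul_right _ _ (Real.exp_ne_zero c)]

theorem mean_add_flat {lam a : E} (ha : a ∈ flat ν T) : mean ν T (lam + a) = mean ν T lam := by
  obtain ⟨c, hc⟩ := ha
  rw [mean, tilted_add_flat hc, mean]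

end Flat

section Derivative

theorem measurable_apply (hT : Measurable T) (l : E) : Measurable fun x => T x l :=
  (ContinuousLinearMap.apply ℝ ℝ l).continuous.measurable.comp hT

variable [FiniteDimensional ℝ E]

/-- Near an interior parameter, the derivatives of the density are dominated by the densities at
the vertices of a simplex inside the domain. -/
theorem exists_dominating {lam : E} (h : lam ∈ interior (domain ν T)) :
    ∃ r > 0, ∃ bound : α → ℝ, Integrable bound ν ∧
      ∀ x, ∀ l ∈ Metric.ball lam r, ‖T x‖ * Real.exp (T x l) ≤ bound x := by
  obtain ⟨b, hb, hbd⟩ :=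
    exists_mem_interior_convexHull_affineBasis (mem_interior_iff_mem_nhds.1 h)
  obtain ⟨r, hr, hball⟩ := Metric.isOpen_iff.1 isOpen_interior lam hb
  refine ⟨r / 2, by positivity, fun x => (r / 2)⁻¹ * ∑ j, Real.exp (T x (b j)), ?_, ?_⟩
  · refine Integrable.const_mul (integrable_finsetSum _ fun j _ => ?_) _
    exact hbd (subset_convexHull ℝ _ (mem_range_self j))
  · intro x l hl
    set S := ∑ j, Real.exp (T x (b j))
    have hS : 0 < S := Finset.sum_pos (fun j _ => Real.exp_pos _) Finset.univ_nonempty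
    have hhull : ∀ y ∈ convexHull ℝ (range b), T x y ≤ Real.log S := by
      intro y hy
      refine convexHull_min (s := range b) (t := {y | T x y ≤ Real.log S}) ?_
        (convex_halfSpace_le (T x).toLinearMap.isLinear _) hy
      rintro _ ⟨j, rfl⟩
      rw [mem_ofPred_eq, Real.le_log_iff_exp_le hS]
      exact Finset.single_le_sum (f := fun j => Real.exp (T x (b j)))
        (fun j _ => (Real.exp_pos _).le) (Finset.mem_univ j)
    -- Moving from `l` by `r / 2` in any direction stays in the simplex, so `‖T x‖` is controlled.
    have hl' : ∀ v : E, ‖v‖ ≤ 1 → T x l + r / 2 * T x v ≤ Real.log S := by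
      intro v hv
      have : l + (r / 2) • v ∈ convexHull ℝ (range b) := by
        refine interior_subset (hball ?_)
        rw [Metric.mem_ball, dist_eq_norm] at hl ⊢
        calc ‖l + (r / 2) • v - lam‖ = ‖(l - lam) + (r / 2) • v‖ := by congr 1; abel
          _ ≤ ‖l - lam‖ + ‖(r / 2) • v‖ := norm_add_le _ _
          _ < r := by
            rw [norm_smul, Real.norm_of_nonneg (by positivity)]
            nlinarith
      simpa using hhull _ this
    have h0 := hl' 0 (by simp)
    have hn : ‖T x‖ ≤ (Real.log S - T x l) / (r / 2) := by
      refine ContinuousLinearMap.opNorm_le_of_unit_norm ?_ fun v hv => ?_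
      · refine div_nonneg ?_ (by positivity)
        simpa using h0
      · rw [Real.norm_eq_abs, abs_le, le_div_iff₀ (by positivity)]
        have h1 := hl' v hv.le
        have h2 := hl' (-v) (by simp [hv])
        rw [map_neg] at h2
        refine ⟨?_, by linarith⟩
        rw [neg_le, le_div_iff₀ (by positivity)]
        linarith
    rw [le_div_iff₀ (by positivity)] at hn
    have h3 : Real.exp (‖T x‖ * (r / 2) + T x l) ≤ S := by
      rw [← Real.le_log_iff_exp_le hS]; linarith
    rw [Real.exp_add] at h3
    have h4 : ‖T x‖ * (r / 2) ≤ Real.exp (‖T x‖ * (r / 2)) := by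
      linarith [Real.add_one_le_exp (‖T x‖ * (r / 2))]
    change _ ≤ (r / 2)⁻¹ * S
    rw [inv_mul_eq_div, le_div_iff₀ (by positivity)]
    nlinarith [Real.exp_pos (T x l)]

theorem integrable_tilted (hT : Measurable T) {lam : E} (h : lam ∈ interior (domain ν T)) :
    Integrable T (ν.tilted fun x => T x lam) := by
  obtain ⟨r, hr, bound, hb, hle⟩ := exists_dominating h
  rw [integrable_tilted_iff (mem_domain.1 (interior_subset h))]
  refine hb.mono' ?_ (ae_of_all _ fun x => ?_)
  · exact ((measurable_apply hT lam).exp.smul hT).aestronglyMeasurable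
  · rw [norm_smul, Real.norm_of_nonneg (Real.exp_pos _).le, mul_comm]
    exact hle x lam (Metric.mem_ball_self hr)

theorem mean_apply (hT : Measurable T) {lam : E} (h : lam ∈ interior (domain ν T)) (v : E) :
    mean ν T lam v = ∫ x, T x v ∂(ν.tilted fun x => T x lam) :=
  ContinuousLinearMap.integral_apply (integrable_tilted hT h) v

theorem hasFDerivAt_logPartition [NeZero ν] (hT : Measurable T) {lam : E}
    (h : lam ∈ interior (domain ν T)) :
    HasFDerivAt (logPartition ν T) (mean ν T lam) lam := by
  obtain ⟨r, hr, bound, hb, hle⟩ := exists_dominating h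
  have hd := interior_subset h
  have hZ : HasFDerivAt (fun l => ∫ x, Real.exp (T x l) ∂ν)
      (∫ x, Real.exp (T x lam) • T x ∂ν) lam := by
    refine hasFDerivAt_integral_of_dominated_of_fderiv_le (F := fun l x => Real.exp (T x l))
      (F' := fun l x => Real.exp (T x l) • T x) (bound := bound) (Metric.ball_mem_nhds lam hr)
      (Filter.Eventually.of_forall fun l =>
        (measurable_apply hT l).exp.aestronglyMeasurable) hd
      ((measurable_apply hT lam).exp.smul hT).aestronglyMeasurable
      (ae_of_all _ fun x l hl => ?_) hb (ae_of_all _ fun x l _ => (T x).hasFDerivAt.exp)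
    rw [norm_smul, Real.norm_of_nonneg (Real.exp_pos _).le, mul_comm]
    exact hle x l hl
  have hmean : mean ν T lam =
      (∫ x, Real.exp (T x lam) ∂ν)⁻¹ • ∫ x, Real.exp (T x lam) • T x ∂ν := by
    unfold mean
    rw [integral_tilted, ← integral_smul]
    congr 1
    ext1 x
    rw [smul_smul, div_eq_inv_mul]
  rw [hmean]
  exact hZ.log (partition_pos hd).ne'

/-- The second-order remainder of the exponential of the centred energy integrates to the
exponential of the Bregman divergence, minus one. -/
theorem integral_exp_centered [NeZero ν] (hT : Measurable T) {lam l : E}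
    (h : lam ∈ interior (domain ν T)) (hl : l ∈ domain ν T) :
    Integrable (fun x => Real.exp (T x (l - lam) - mean ν T lam (l - lam)) - 1 -
        (T x (l - lam) - mean ν T lam (l - lam))) (ν.tilted fun x => T x lam) ∧
      ∫ x, (Real.exp (T x (l - lam) - mean ν T lam (l - lam)) - 1 -
        (T x (l - lam) - mean ν T lam (l - lam))) ∂(ν.tilted fun x => T x lam) =
      Real.exp (logPartition ν T l - logPartition ν T lam - mean ν T lam (l - lam)) - 1 := by
  have hd := interior_subset h
  have := isProbabilityMeasure_tilted hd
  have hexp : (fun x => Real.exp (T x (l - lam) - mean ν T lam (l - lam))) = fun x =>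
      Real.exp (-mean ν T lam (l - lam)) * Real.exp (T x (l - lam)) := by
    ext x
    rw [← Real.exp_add]
    congr 1
    ring
  have i1 : Integrable (fun x => Real.exp (T x (l - lam))) (ν.tilted fun x => T x lam) := by
    rw [integrable_tilted_iff (mem_domain.1 hd)]
    refine (mem_domain.1 hl).congr (ae_of_all _ fun x => ?_)
    simp [← Real.exp_add]
  have i1' : Integrable (fun x => Real.exp (T x (l - lam) - mean ν T lam (l - lam)))
      (ν.tilted fun x => T x lam) := hexp ▸ i1.const_mul _
  have i2 : Integrable (fun x => T x (l - lam)) (ν.tilted fun x => T x lam) :=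
    (integrable_tilted hT h).apply_continuousLinearMap _
  have i3 : Integrable (fun x => Real.exp (T x (l - lam) - mean ν T lam (l - lam)) - 1)
      (ν.tilted fun x => T x lam) := i1'.sub (integrable_const _)
  have i4 : Integrable (fun x => T x (l - lam) - mean ν T lam (l - lam))
      (ν.tilted fun x => T x lam) := i2.sub (integrable_const _)
  refine ⟨i3.sub i4, ?_⟩
  rw [integral_sub i3 i4, integral_sub i1' (integrable_const _), integral_sub i2 (integrable_const _), ← mean_apply hT h,
    hexp, integral_const_mul, integral_exp_tilted]
  have : ∀ x, ((fun x => T x lam) + fun x => T x (l - lam)) x = T x l := by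
    intro x; simp
  simp only [this, integral_const, probReal_univ, smul_eq_mul, mul_one, one_mul, sub_self, sub_zero]
  rw [← exp_logPartition hd, ← exp_logPartition hl, ← Real.exp_sub, ← Real.exp_add]
  congr 2
  ring

/-- The Bregman divergence of the log-partition function is nonnegative. -/
theorem bregman_nonneg [NeZero ν] (hT : Measurable T) {lam l : E}
    (h : lam ∈ interior (domain ν T)) (hl : l ∈ domain ν T) :
    mean ν T lam (l - lam) ≤ logPartition ν T l - logPartition ν T lam := by
  obtain ⟨-, h2⟩ := integral_exp_centered hT h hl
  have h3 := integral_nonneg (μ := ν.tilted fun x => T x lam)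
    (f := fun x => Real.exp (T x (l - lam) - mean ν T lam (l - lam)) - 1 -
        (T x (l - lam) - mean ν T lam (l - lam))) fun x => by
      have := Real.add_one_le_exp (T x (l - lam) - mean ν T lam (l - lam))
      simp only [Pi.zero_apply]
      linarith
  rw [h2, sub_nonneg, Real.one_le_exp_iff] at h3
  linarith

/-- The Bregman divergence vanishes only along the directions of constant energy. -/
theorem sub_mem_flat_of_bregman_le [NeZero ν] (hT : Measurable T) {lam l : E}
    (h : lam ∈ interior (domain ν T)) (hl : l ∈ domain ν T)
    (hle : logPartition ν T l - logPartition ν T lam ≤ mean ν T lam (l - lam)) :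
    l - lam ∈ flat ν T := by
  obtain ⟨h1, h2⟩ := integral_exp_centered hT h hl
  have hnn : 0 ≤ fun x => Real.exp (T x (l - lam) - mean ν T lam (l - lam)) - 1 -
        (T x (l - lam) - mean ν T lam (l - lam)) := fun x => by
      have := Real.add_one_le_exp (T x (l - lam) - mean ν T lam (l - lam))
      simp only [Pi.zero_apply]
      linarith
  have h0 : Real.exp (logPartition ν T l - logPartition ν T lam - mean ν T lam (l - lam)) - 1 ≤ 0 := by
    rw [sub_nonpos, Real.exp_le_one_iff]
    linarith
  have h3 := (integral_eq_zero_iff_of_nonneg hnn h1).1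
    (le_antisymm (h2.trans_le h0) (integral_nonneg hnn))
  refine ⟨mean ν T lam (l - lam), ?_⟩
  filter_upwards [(absolutelyContinuous_tilted (mem_domain.1 (interior_subset h))).ae_eq h3]
    with x hx
  by_contra hne
  have := Real.add_one_lt_exp (sub_ne_zero.2 hne)
  simp only [Pi.zero_apply] at hx
  linarith

/-- The mean map is injective modulo the directions of constant energy. -/
theorem sub_mem_flat_of_mean_eq [NeZero ν] (hT : Measurable T) {lam l : E}
    (h : lam ∈ interior (domain ν T)) (hl : l ∈ interior (domain ν T))
    (heq : mean ν T l = mean ν T lam) : l - lam ∈ flat ν T := by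
  refine sub_mem_flat_of_bregman_le hT h (interior_subset hl) ?_
  have := bregman_nonneg hT hl (interior_subset h)
  rw [heq, map_sub] at this
  rw [map_sub]
  linarith

theorem mean_apply_flat [NeZero ν] (hT : Measurable T) {lam a : E} {c : ℝ}
    (h : lam ∈ interior (domain ν T)) (hc : ∀ᵐ x ∂ν, T x a = c) : mean ν T lam a = c := by
  have := isProbabilityMeasure_tilted (interior_subset h)
  rw [mean_apply hT h, integral_congr_ae ((tilted_absolutelyContinuous _ _).ae_le hc)]
  simp

/-- Transversally to the directions of constant energy, the Bregman divergence grows linearly. -/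
theorem exists_coercive [NeZero ν] (hT : Measurable T) {lam : E}
    (h : lam ∈ interior (domain ν T)) {K : Submodule ℝ E} (hK : Disjoint (flat ν T) K) {ε : ℝ}
    (hε : 0 < ε) : ∃ η > 0, ∀ k ∈ K, lam + k ∈ domain ν T → ε ≤ ‖k‖ →
      η * ‖k‖ ≤ logPartition ν T (lam + k) - logPartition ν T lam - mean ν T lam k := by
  have hm := measurable_apply hT
  obtain ⟨r, hr, hball⟩ := Metric.isOpen_iff.1 isOpen_interior lam h
  -- The divergence is positive on a small compact sphere inside the domain; convexity along rays
  -- from `lam` propagates the bound outwards, also to parameters that are not interior.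
  set ε' := min ε (r / 2)
  have hε' : 0 < ε' := lt_min hε (by positivity)
  have hmem : ∀ k : E, ‖k‖ = ε' → lam + k ∈ interior (domain ν T) := by
    intro k hk
    apply hball
    rw [Metric.mem_ball, dist_eq_norm, add_sub_cancel_left, hk]
    exact (min_le_right _ _).trans_lt (by linarith)
  have hcomp : IsCompact (Metric.sphere (0 : E) ε' ∩ (K : Set E)) :=
    (isCompact_sphere 0 ε').inter_right K.closed_of_finiteDimensional
  obtain ⟨η, hη, hle⟩ := hcomp.exists_forall_le' (a := 0)
    (f := fun k => logPartition ν T (lam + k) - logPartition ν T lam - mean ν T lam k)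
    (by
      refine ContinuousOn.sub (ContinuousOn.sub ?_ continuousOn_const)
        (mean ν T lam).continuous.continuousOn
      intro k hk
      have h1 := (hasFDerivAt_logPartition hT (hmem k (by simpa using hk.1))).continuousAt
      exact (ContinuousAt.comp (f := fun k => lam + k) h1
        (continuous_const_add lam).continuousAt).continuousWithinAt)
    (by
      intro k hk
      have hkn : ‖k‖ = ε' := by simpa using hk.1
      by_contra hcon
      have := sub_mem_flat_of_bregman_le hT h (interior_subset (hmem k hkn))
        (by rw [add_sub_cancel_left]; linarith)
      rw [add_sub_cancel_left] at this
      have := Submodule.disjoint_def.1 hK k this hk.2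
      rw [this, norm_zero] at hkn
      exact hε'.ne hkn)
  refine ⟨η / ε', by positivity, fun k hk hdom hkn => ?_⟩
  have hk0 : 0 < ‖k‖ := hε.trans_le hkn
  set t := ε' / ‖k‖
  have ht0 : 0 ≤ t := by positivity
  have ht1 : t ≤ 1 := (div_le_one hk0).2 ((min_le_left _ _).trans hkn)
  have h1 := hle (t • k) ⟨by
    rw [mem_sphere_zero_iff_norm, norm_smul, Real.norm_of_nonneg ht0]
    exact div_mul_cancel₀ _ hk0.ne', K.smul_mem _ hk⟩
  have h2 := (logPartition_combo hm (interior_subset h) hdom (sub_nonneg.2 ht1) ht0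
    (sub_add_cancel 1 t)).2
  have e : (1 - t) • lam + t • (lam + k) = lam + t • k := by module
  rw [e] at h2
  simp only [map_smul, smul_eq_mul] at h1
  have h3 : η ≤ t * (logPartition ν T (lam + k) - logPartition ν T lam - mean ν T lam k) := by
    linarith
  have h4 : η / ε' * ‖k‖ = η / t := by
    simp only [t]
    field_simp
  rw [h4, div_le_iff₀' (by positivity)]
  exact h3

end Derivative

section Legendre

variable [FiniteDimensional ℝ E]

theorem legendre_mean [NeZero ν] (hT : Measurable T) {lam : E}
    (h : lam ∈ interior (domain ν T)) :
    legendre ν T (mean ν T lam) = ((mean ν T lam lam - logPartition ν T lam : ℝ) : EReal) := by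
  refine le_antisymm (legendre_le_iff.2 fun l hl => ?_) (le_legendre (interior_subset h) _)
  have := bregman_nonneg hT h hl
  rw [map_sub] at this
  linarith

/-- A first-order upper bound on the Legendre transform at a mean, in the directions in which the
mean can move. -/
theorem exists_legendre_le [NeZero ν] (hT : Measurable T) {lam : E}
    (h : lam ∈ interior (domain ν T)) {δ : StrongDual ℝ E} (hδ : ∀ a ∈ flat ν T, δ a = 0) {ε : ℝ}
    (hε : 0 < ε) : ∃ ρ > 0, ∀ t : ℝ, |t| < ρ → legendre ν T (mean ν T lam + t • δ) ≤
      ((mean ν T lam lam - logPartition ν T lam + t * δ lam + |t| * ε : ℝ) : EReal) := by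
  obtain ⟨K, hK⟩ := (flat ν T).exists_isCompl
  have hD : 0 < ‖δ‖ + 1 := by positivity
  obtain ⟨η, hη, hco⟩ := exists_coercive hT h hK.disjoint (ε := ε / (‖δ‖ + 1)) (by positivity)
  refine ⟨η / (‖δ‖ + 1), by positivity, fun t ht => legendre_le_iff.2 fun l hl => ?_⟩
  obtain ⟨a, ha, k, hk, hak⟩ : ∃ a ∈ flat ν T, ∃ k ∈ K, a + k = l - lam :=
    Submodule.mem_sup.1 (hK.sup_eq_top ▸ Submodule.mem_top)
  have hlk : lam + k ∈ domain ν T := by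
    rw [← domain_add_flat ha]
    convert hl using 1
    rw [add_assoc, add_comm k, hak]
    abel
  have hl_eq : l = lam + k + a := by
    rw [add_assoc, add_comm k, hak]
    abel
  obtain ⟨c, hc⟩ := ha
  have hA := (add_flat hc hlk).2
  have hma := mean_apply_flat hT h hc
  have hδa := hδ a ⟨c, hc⟩
  rw [lt_div_iff₀ hD] at ht
  have hbound : t * δ k ≤ |t| * (‖δ‖ * ‖k‖) := by
    refine (le_abs_self _).trans ?_
    rw [abs_mul]
    exact mul_le_mul_of_nonneg_left (δ.le_opNorm k) (abs_nonneg t)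
  -- Large displacements are dominated by the linear growth, small ones by their size.
  have hmain : t * δ k - (logPartition ν T (lam + k) - logPartition ν T lam - mean ν T lam k) ≤
      |t| * ε := by
    rcases le_or_gt (ε / (‖δ‖ + 1)) ‖k‖ with hk' | hk'
    · have h1 := hco k hk hlk hk'
      have h2 : |t| * (‖δ‖ * ‖k‖) ≤ η * ‖k‖ := by
        rw [← mul_assoc]
        refine mul_le_mul_of_nonneg_right ?_ (norm_nonneg k)
        nlinarith [abs_nonneg t]
      have h3 : 0 ≤ |t| * ε := by positivity
      linarith
    · have h1 := bregman_nonneg hT h hlk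
      rw [add_sub_cancel_left] at h1
      rw [lt_div_iff₀ hD] at hk'
      have h2 : |t| * (‖δ‖ * ‖k‖) ≤ |t| * ε := by
        refine mul_le_mul_of_nonneg_left ?_ (abs_nonneg t)
        nlinarith [norm_nonneg k]
      linarith
  rw [hl_eq, hA]
  simp only [add_apply, smul_apply, map_add, smul_eq_mul,
    hma, hδa]
  linarith

theorem eventually_legendre_ne_top [NeZero ν] (hT : Measurable T) {lam : E}
    (h : lam ∈ interior (domain ν T)) {δ : StrongDual ℝ E} (hδ : ∀ a ∈ flat ν T, δ a = 0) :
    ∀ᶠ t : ℝ in nhds 0, legendre ν T (mean ν T lam + t • δ) ≠ ⊤ := by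
  obtain ⟨ρ, hρ, hle⟩ := exists_legendre_le hT h hδ one_pos
  filter_upwards [Metric.ball_mem_nhds (0 : ℝ) hρ] with t ht
  rw [Metric.mem_ball, dist_zero_right] at ht
  exact ((hle t ht).trans_lt (EReal.coe_lt_top _)).ne

/-- The gradient of the Legendre transform at a mean is the natural parameter, in the directions
in which the mean can move. -/
theorem hasDerivAt_legendre [NeZero ν] (hT : Measurable T) {lam : E}
    (h : lam ∈ interior (domain ν T)) {δ : StrongDual ℝ E} (hδ : ∀ a ∈ flat ν T, δ a = 0) :
    HasDerivAt (fun t : ℝ => (legendre ν T (mean ν T lam + t • δ)).toReal) (δ lam) 0 := by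
  rw [hasDerivAt_iff_isLittleO_nhds_zero, Asymptotics.isLittleO_iff]
  intro ε hε
  obtain ⟨ρ, hρ, hle⟩ := exists_legendre_le hT h hδ hε
  filter_upwards [Metric.ball_mem_nhds (0 : ℝ) hρ, eventually_legendre_ne_top hT h hδ] with t ht hne
  rw [Metric.mem_ball, dist_zero_right] at ht
  have h1 := hle t ht
  have h2 := le_legendre (interior_subset h) (mean ν T lam + t • δ)
  rw [← coe_toReal_legendre ⟨lam, interior_subset h⟩ hne, EReal.coe_le_coe_iff] at h1 h2
  simp only [zero_add, zero_smul, add_zero, legendre_mean hT h, EReal.toReal_coe, smul_eq_mul]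
  simp only [add_apply, smul_apply, smul_eq_mul] at h2
  rw [Real.norm_eq_abs, Real.norm_eq_abs, abs_le]
  have h3 : 0 ≤ ε * |t| := by positivity
  constructor <;> linarith

end Legendre

end ExpFamily
end

/-! ### Relative entropy -/

noncomputable section

namespace ExpFamily

/-- The mixture `(1 - t) p + t q`. -/
def mixture {α : Type*} [MeasurableSpace α] (p q : Measure α) (t : ℝ) : Measure α :=
  ENNReal.ofReal (1 - t) • p + ENNReal.ofReal t • q

/-- Probability measures whose entropy relative to `ν` and whose mean statistic are well defined. -/
structure IsAdmissible {α : Type*} [MeasurableSpace α] {E : Type*} [NormedAddCommGroup E]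
    [NormedSpace ℝ E] (ν : Measure α) (T : α → StrongDual ℝ E) (p : Measure α) : Prop where
  prob : IsProbabilityMeasure p
  ac : p ≪ ν
  integrable_llr : Integrable (llr p ν) p
  integrable_stat : Integrable T p

open TreeModel (relEnt)

section Mixture

variable {α : Type*} [MeasurableSpace α] {p q ν : Measure α} {t : ℝ}

@[simp]
theorem mixture_zero : mixture p q 0 = p := by simp [mixture]

theorem mixture_self (ht : t ∈ Icc (0 : ℝ) 1) : mixture p p t = p := by
  rw [mixture, ← add_smul, ← ENNReal.ofReal_add (by linarith [ht.2]) ht.1]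
  simp

theorem isProbabilityMeasure_mixture [IsProbabilityMeasure p] [IsProbabilityMeasure q]
    (ht : t ∈ Icc (0 : ℝ) 1) : IsProbabilityMeasure (mixture p q t) := by
  constructor
  simp only [mixture, Measure.add_apply, Measure.smul_apply, measure_univ, smul_eq_mul, mul_one]
  rw [← ENNReal.ofReal_add (by linarith [ht.2]) ht.1]
  simp

theorem mixture_ac (hp : p ≪ ν) (hq : q ≪ ν) : mixture p q t ≪ ν :=
  Measure.AbsolutelyContinuous.add_left (hp.smul_left _) (hq.smul_left _)

theorem integrable_mixture {G : Type*} [NormedAddCommGroup G] {f : α → G} (hp : Integrable f p)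
    (hq : Integrable f q) : Integrable f (mixture p q t) :=
  (hp.smul_measure ENNReal.ofReal_ne_top).add_measure (hq.smul_measure ENNReal.ofReal_ne_top)

theorem integral_mixture {G : Type*} [NormedAddCommGroup G] [NormedSpace ℝ G] {f : α → G}
    (hp : Integrable f p) (hq : Integrable f q) (ht : t ∈ Icc (0 : ℝ) 1) :
    ∫ x, f x ∂(mixture p q t) = (1 - t) • ∫ x, f x ∂p + t • ∫ x, f x ∂q := by
  rw [mixture, integral_add_measure (hp.smul_measure ENNReal.ofReal_ne_top)
    (hq.smul_measure ENNReal.ofReal_ne_top), integral_smul_measure, integral_smul_measure,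
    ENNReal.toReal_ofReal (by linarith [ht.2]), ENNReal.toReal_ofReal ht.1]

theorem toReal_rnDeriv_mixture [SigmaFinite ν] [IsProbabilityMeasure p] [IsProbabilityMeasure q]
    (ht : t ∈ Icc (0 : ℝ) 1) : ∀ᵐ x ∂ν, ((mixture p q t).rnDeriv ν x).toReal =
      (1 - t) * (p.rnDeriv ν x).toReal + t * (q.rnDeriv ν x).toReal := by
  have : IsFiniteMeasure (ENNReal.ofReal (1 - t) • p) := p.smul_finite ENNReal.ofReal_ne_top
  have : IsFiniteMeasure (ENNReal.ofReal t • q) := q.smul_finite ENNReal.ofReal_ne_top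
  filter_upwards [Measure.rnDeriv_add (ENNReal.ofReal (1 - t) • p) (ENNReal.ofReal t • q) ν,
    Measure.rnDeriv_smul_left_of_ne_top p ν (r := ENNReal.ofReal (1 - t)) ENNReal.ofReal_ne_top,
    Measure.rnDeriv_smul_left_of_ne_top q ν (r := ENNReal.ofReal t) ENNReal.ofReal_ne_top,
    p.rnDeriv_ne_top ν, q.rnDeriv_ne_top ν] with x h1 h2 h3 h4 h5
  rw [mixture, h1, Pi.add_apply, h2, h3, Pi.smul_apply, Pi.smul_apply, smul_eq_mul, smul_eq_mul,
    ENNReal.toReal_add (ENNReal.mul_ne_top ENNReal.ofReal_ne_top h4)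
      (ENNReal.mul_ne_top ENNReal.ofReal_ne_top h5), ENNReal.toReal_mul, ENNReal.toReal_mul,
    ENNReal.toReal_ofReal (by linarith [ht.2]), ENNReal.toReal_ofReal ht.1]

theorem mul_log_superadditive {u v : ℝ} (hu : 0 ≤ u) (hv : 0 ≤ v) :
    u * Real.log u + v * Real.log v ≤ (u + v) * Real.log (u + v) := by
  have aux : ∀ {u v : ℝ}, 0 ≤ u → 0 ≤ v → u * Real.log u ≤ u * Real.log (u + v) := by
    intro u v hu hv
    rcases hu.eq_or_lt with rfl | hu
    · simp
    · exact mul_le_mul_of_nonneg_left (Real.log_le_log hu (by linarith)) hu.le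
  have h1 := aux hu hv
  have h2 := aux hv hu
  rw [add_comm v u] at h2
  linarith

theorem relEnt_eq_integral_mul_log [SigmaFinite ν] [IsProbabilityMeasure p] (hp : p ≪ ν) :
    relEnt p ν = ∫ x, (p.rnDeriv ν x).toReal * Real.log (p.rnDeriv ν x).toReal ∂ν :=
  (integral_rnDeriv_mul_log hp).symm

/-- The relative entropy is convex along mixtures, and stays well defined. -/
theorem relEnt_mixture_le [SigmaFinite ν] [IsProbabilityMeasure p] [IsProbabilityMeasure q]
    (hp : p ≪ ν) (hq : q ≪ ν) (hpi : Integrable (llr p ν) p) (hqi : Integrable (llr q ν) q)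
    (ht : t ∈ Icc (0 : ℝ) 1) :
    Integrable (llr (mixture p q t) ν) (mixture p q t) ∧
      relEnt (mixture p q t) ν ≤ (1 - t) * relEnt p ν + t * relEnt q ν := by
  have hm : mixture p q t ≪ ν := mixture_ac hp hq
  have := isProbabilityMeasure_mixture (p := p) (q := q) ht
  have ht' : 0 ≤ 1 - t := by linarith [ht.2]
  have ip := (integrable_rnDeriv_mul_log_iff hp).2 hpi
  have iq := (integrable_rnDeriv_mul_log_iff hq).2 hqi
  have rp : Integrable (fun x => (p.rnDeriv ν x).toReal) ν := Measure.integrable_toReal_rnDeriv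
  have rq : Integrable (fun x => (q.rnDeriv ν x).toReal) ν := Measure.integrable_toReal_rnDeriv
  have iup : Integrable (fun x => (1 - t) * ((p.rnDeriv ν x).toReal *
      Real.log (p.rnDeriv ν x).toReal) + t * ((q.rnDeriv ν x).toReal *
      Real.log (q.rnDeriv ν x).toReal)) ν := (ip.const_mul _).add (iq.const_mul _)
  have hup : ∀ᵐ x ∂ν, ((mixture p q t).rnDeriv ν x).toReal *
      Real.log ((mixture p q t).rnDeriv ν x).toReal ≤ (1 - t) * ((p.rnDeriv ν x).toReal *
      Real.log (p.rnDeriv ν x).toReal) + t * ((q.rnDeriv ν x).toReal *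
      Real.log (q.rnDeriv ν x).toReal) := by
    filter_upwards [toReal_rnDeriv_mixture (p := p) (q := q) (ν := ν) ht] with x hx
    rw [hx]
    have := Real.convexOn_mul_log.2 (x := (p.rnDeriv ν x).toReal) (y := (q.rnDeriv ν x).toReal)
      (mem_Ici.2 ENNReal.toReal_nonneg) (mem_Ici.2 ENNReal.toReal_nonneg) ht' ht.1 (by ring)
    simpa only [smul_eq_mul] using this
  have imix : Integrable (fun x => ((mixture p q t).rnDeriv ν x).toReal *
      Real.log ((mixture p q t).rnDeriv ν x).toReal) ν := by
    refine integrable_of_le_of_le (g₁ := fun x =>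
      ((1 - t) * ((p.rnDeriv ν x).toReal * Real.log (p.rnDeriv ν x).toReal) +
        ((1 - t) * Real.log (1 - t)) * (p.rnDeriv ν x).toReal) +
      (t * ((q.rnDeriv ν x).toReal * Real.log (q.rnDeriv ν x).toReal) +
        (t * Real.log t) * (q.rnDeriv ν x).toReal)) ?_ ?_ hup
      (((ip.const_mul _).add (rp.const_mul _)).add ((iq.const_mul _).add (rq.const_mul _))) iup
    · have := ((mixture p q t).measurable_rnDeriv ν).ennreal_toReal
      exact (this.mul this.log).aestronglyMeasurable
    · filter_upwards [toReal_rnDeriv_mixture (p := p) (q := q) (ν := ν) ht] with x hx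
      rw [hx]
      have h1 := mul_log_superadditive (mul_nonneg ht' (p.rnDeriv ν x).toReal_nonneg)
        (mul_nonneg ht.1 (q.rnDeriv ν x).toReal_nonneg)
      have h2 := Real.negMulLog_mul (1 - t) (p.rnDeriv ν x).toReal
      have h3 := Real.negMulLog_mul t (q.rnDeriv ν x).toReal
      simp only [Real.negMulLog] at h2 h3
      linarith
  refine ⟨(integrable_rnDeriv_mul_log_iff hm).1 imix, ?_⟩
  rw [relEnt_eq_integral_mul_log hm, relEnt_eq_integral_mul_log hp, relEnt_eq_integral_mul_log hq,
    ← integral_const_mul, ← integral_const_mul, ← integral_add (ip.const_mul _) (iq.const_mul _)]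
  exact integral_mono_ae imix iup hup

/-- The Kullback-Leibler divergence relative to `p` has a vanishing first variation at `p`. In the
form `∫ klFun (1 + t (g - 1)) dp` its difference quotients are dominated by `klFun g`. -/
theorem hasDerivWithinAt_integral_llr_mixture [IsProbabilityMeasure p] [IsProbabilityMeasure q]
    (hq : q ≪ p) (hqi : Integrable (llr q p) q) :
    HasDerivWithinAt (fun t => ∫ x, llr (mixture p q t) p x ∂(mixture p q t)) 0 (Ici 0) 0 := by
  have hpi : Integrable (llr p p) p := (integrable_zero _ _ _).congr (llr_self p).symm
  set g : α → ℝ := fun x => (q.rnDeriv p x).toReal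
  have hself : ∀ᵐ x ∂p, (p.rnDeriv p x).toReal = 1 := by
    filter_upwards [p.rnDeriv_self] with x hx
    simp [hx]
  have hval : ∀ t ∈ Icc (0 : ℝ) 1, ∫ x, llr (mixture p q t) p x ∂(mixture p q t) =
      ∫ x, InformationTheory.klFun (1 + t * (g x - 1)) ∂p := by
    intro t ht
    have := isProbabilityMeasure_mixture (p := p) (q := q) ht
    have h1 := InformationTheory.integral_klFun_rnDeriv
      (mixture_ac (t := t) Measure.AbsolutelyContinuous.rfl hq)
      (relEnt_mixture_le Measure.AbsolutelyContinuous.rfl hq hpi hqi ht).1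
    simp only [probReal_univ, add_sub_cancel_right] at h1
    rw [← h1]
    refine integral_congr_ae ?_
    filter_upwards [toReal_rnDeriv_mixture (p := p) (q := q) (ν := p) ht, hself] with x hx hx'
    rw [hx, hx']
    congr 1
    ring
  rw [← hasDerivWithinAt_Ioi_iff_Ici, hasDerivWithinAt_iff_tendsto_slope' (by simp)]
  have hev : ∀ᶠ t : ℝ in nhdsWithin 0 (Ioi 0), t ∈ Ioc (0 : ℝ) 1 := Ioc_mem_nhdsGT one_pos
  have hlim : Filter.Tendsto (fun t : ℝ => ∫ x, t⁻¹ * InformationTheory.klFun (1 + t * (g x - 1)) ∂p)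
      (nhdsWithin 0 (Ioi 0)) (nhds (∫ _x, (0 : ℝ) ∂p)) := by
    refine tendsto_integral_filter_of_dominated_convergence
      (fun x => InformationTheory.klFun (g x)) ?_ ?_ ?_ ?_
    · refine Filter.Eventually.of_forall fun t => ?_
      have hg : Measurable g := (q.measurable_rnDeriv p).ennreal_toReal
      exact ((InformationTheory.measurable_klFun.comp
        (((hg.sub_const 1).const_mul t).const_add 1)).const_mul _).aestronglyMeasurable
    · filter_upwards [hev] with t ht
      refine ae_of_all _ fun x => ?_
      have hg0 : 0 ≤ g x := ENNReal.toReal_nonneg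
      have hcomb := InformationTheory.convexOn_klFun.2 (x := 1) (y := g x) (by simp)
        (mem_Ici.2 hg0) (by linarith [ht.2] : 0 ≤ 1 - t) ht.1.le (by ring)
      simp only [smul_eq_mul, InformationTheory.klFun_one, mul_zero, zero_add, mul_one] at hcomb
      have e : 1 - t + t * g x = 1 + t * (g x - 1) := by ring
      rw [e] at hcomb
      have hnn : 0 ≤ InformationTheory.klFun (1 + t * (g x - 1)) :=
        InformationTheory.klFun_nonneg (by nlinarith [ht.1, ht.2])
      rw [Real.norm_of_nonneg (mul_nonneg (inv_nonneg.2 ht.1.le) hnn), inv_mul_eq_div,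
        div_le_iff₀' ht.1]
      exact hcomb
    · exact (InformationTheory.integrable_klFun_rnDeriv_iff hq).2 hqi
    · refine ae_of_all _ fun x => ?_
      have h1 : HasDerivAt (fun t : ℝ => InformationTheory.klFun (1 + t * (g x - 1)))
          (Real.log 1 * (g x - 1)) 0 := by
        have h2 : HasDerivAt (fun t : ℝ => 1 + t * (g x - 1)) (g x - 1) 0 := by
          simpa using ((hasDerivAt_id (0 : ℝ)).mul_const (g x - 1)).const_add 1
        have h3 : HasDerivAt InformationTheory.klFun (Real.log 1) (1 + 0 * (g x - 1)) := by
          simpa using InformationTheory.hasDerivAt_klFun one_ne_zero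
        exact h3.comp 0 h2
      have h4 := (hasDerivAt_iff_tendsto_slope_zero.1 h1).mono_left
        (nhdsWithin_mono 0 (fun t (ht : t ∈ Ioi (0 : ℝ)) => (mem_Ioi.1 ht).ne'))
      simpa [InformationTheory.klFun_one] using h4
  rw [integral_zero] at hlim
  refine hlim.congr' ?_
  filter_upwards [hev] with t ht
  rw [slope_def_module, hval t ⟨ht.1.le, ht.2⟩, hval 0 (by simp), integral_const_mul]
  simp [InformationTheory.klFun_one]

end Mixture

section Variational

variable {α : Type*} [MeasurableSpace α] {E : Type*} [NormedAddCommGroup E] [NormedSpace ℝ E]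
  {ν : Measure α} {T : α → StrongDual ℝ E} {p q : Measure α} {lam : E}

theorem IsAdmissible.mixture [SigmaFinite ν] (hp : IsAdmissible ν T p) (hq : IsAdmissible ν T q)
    {t : ℝ} (ht : t ∈ Icc (0 : ℝ) 1) : IsAdmissible ν T (mixture p q t) := by
  have := hp.prob
  have := hq.prob
  exact ⟨isProbabilityMeasure_mixture ht, mixture_ac hp.ac hq.ac,
    (relEnt_mixture_le hp.ac hq.ac hp.integrable_llr hq.integrable_llr ht).1,
    integrable_mixture hp.integrable_stat hq.integrable_stat⟩

theorem IsAdmissible.relEnt_eq [SigmaFinite ν] [FiniteDimensional ℝ E] (hp : IsAdmissible ν T p)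
    (h : lam ∈ domain ν T) : relEnt p ν = (∫ x, T x ∂p) lam - logPartition ν T lam +
      ∫ x, llr p (ν.tilted fun x => T x lam) x ∂p := by
  have := hp.prob
  rw [integral_llr_tilted_right hp.ac (hp.integrable_stat.apply_continuousLinearMap lam)
    h hp.integrable_llr, ContinuousLinearMap.integral_apply hp.integrable_stat, logPartition, relEnt]
  ring

/-- The Gibbs variational inequality. -/
theorem IsAdmissible.le_relEnt [SigmaFinite ν] [NeZero ν] [FiniteDimensional ℝ E]
    (hp : IsAdmissible ν T p) (h : lam ∈ domain ν T) :
    (∫ x, T x ∂p) lam - logPartition ν T lam ≤ relEnt p ν := by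
  have := hp.prob
  have := isProbabilityMeasure_tilted h
  have h1 := InformationTheory.integral_llr_add_sub_measure_univ_nonneg
    (hp.ac.trans (absolutelyContinuous_tilted h))
    (integrable_llr_tilted_right hp.ac (hp.integrable_stat.apply_continuousLinearMap lam)
      hp.integrable_llr h)
  simp only [probReal_univ, add_sub_cancel_right] at h1
  rw [hp.relEnt_eq h]
  linarith

theorem IsAdmissible.legendre_le [SigmaFinite ν] [NeZero ν] [FiniteDimensional ℝ E]
    (hp : IsAdmissible ν T p) : legendre ν T (∫ x, T x ∂p) ≤ (relEnt p ν : EReal) :=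
  legendre_le_iff.2 fun _ h => hp.le_relEnt h

theorem llr_tilted [SigmaFinite ν] (h : lam ∈ domain ν T) :
    llr (ν.tilted fun x => T x lam) ν =ᵐ[ν.tilted fun x => T x lam]
      fun x => T x lam - logPartition ν T lam :=
  (tilted_absolutelyContinuous ν _).ae_le (log_rnDeriv_tilted_left_self h)

theorem isAdmissible_tilted [SigmaFinite ν] [NeZero ν] [FiniteDimensional ℝ E] (hT : Measurable T)
    (h : lam ∈ interior (domain ν T)) : IsAdmissible ν T (ν.tilted fun x => T x lam) := by
  have := isProbabilityMeasure_tilted (interior_subset h)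
  refine ⟨this, tilted_absolutelyContinuous _ _, ?_, integrable_tilted hT h⟩
  exact (((integrable_tilted hT h).apply_continuousLinearMap lam).sub
    (integrable_const _)).congr (llr_tilted (interior_subset h)).symm

theorem hasDerivAt_chord (a b : ℝ) :
    HasDerivAt (fun t : ℝ => (1 - t) * a + t * b) (b - a) 0 := by
  have h1 : HasDerivAt (fun t : ℝ => a + t * (b - a)) (b - a) 0 := by
    simpa using ((hasDerivAt_id (0 : ℝ)).mul_const (b - a)).const_add a
  have h2 : (fun t : ℝ => (1 - t) * a + t * b) = fun t => a + t * (b - a) := by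
    ext t
    ring
  rwa [h2]

/-- The first variation of the relative entropy at a member of the exponential family. -/
theorem hasDerivWithinAt_relEnt_tilted [SigmaFinite ν] [NeZero ν] [FiniteDimensional ℝ E]
    (hT : Measurable T) (h : lam ∈ interior (domain ν T)) (hq : IsAdmissible ν T q) :
    HasDerivWithinAt (fun t => relEnt (mixture (ν.tilted fun x => T x lam) q t) ν)
      ((∫ x, T x ∂q) lam - mean ν T lam lam) (Ici 0) 0 := by
  have hd := interior_subset h
  have := isProbabilityMeasure_tilted hd
  have := hq.prob
  have hp := isAdmissible_tilted hT h
  have hac : q ≪ ν.tilted fun x => T x lam := hq.ac.trans (absolutelyContinuous_tilted hd)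
  have h1 := hasDerivWithinAt_integral_llr_mixture hac (integrable_llr_tilted_right hq.ac
    (hq.integrable_stat.apply_continuousLinearMap lam) hq.integrable_llr hd)
  have h2 : HasDerivWithinAt (fun t : ℝ => (1 - t) * mean ν T lam lam + t * (∫ x, T x ∂q) lam -
      logPartition ν T lam) ((∫ x, T x ∂q) lam - mean ν T lam lam) (Ici 0) 0 := by
    exact ((hasDerivAt_chord _ _).sub_const _).hasDerivWithinAt
  have h3 := h2.add h1
  rw [add_zero] at h3
  have heq : ∀ t ∈ Icc (0 : ℝ) 1, relEnt (mixture (ν.tilted fun x => T x lam) q t) ν =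
      (1 - t) * mean ν T lam lam + t * (∫ x, T x ∂q) lam - logPartition ν T lam +
      ∫ x, llr (mixture (ν.tilted fun x => T x lam) q t) (ν.tilted fun x => T x lam) x
        ∂(mixture (ν.tilted fun x => T x lam) q t) := by
    intro t ht
    rw [(hp.mixture hq ht).relEnt_eq hd, integral_mixture hp.integrable_stat hq.integrable_stat ht]
    simp [mean]
  refine h3.congr_of_eventuallyEq ?_ (heq 0 (by simp))
  filter_upwards [Icc_mem_nhdsGE one_pos] with t ht
  exact heq t ht

/-- A one-sided derivative of a function lying below a chord is at most the slope of the chord. -/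
theorem deriv_le_of_le_chord {f : ℝ → ℝ} {d B : ℝ} (hf : HasDerivWithinAt f d (Ici 0) 0)
    (hle : ∀ t ∈ Icc (0 : ℝ) 1, f t ≤ (1 - t) * f 0 + t * B) : d ≤ B - f 0 := by
  rw [← hasDerivWithinAt_Ioi_iff_Ici, hasDerivWithinAt_iff_tendsto_slope' (by simp)] at hf
  refine le_of_tendsto hf ?_
  filter_upwards [Ioc_mem_nhdsGT one_pos] with t ht
  have := hle t ⟨ht.1.le, ht.2⟩
  rw [slope_def_field, sub_zero, div_le_iff₀ ht.1]
  linarith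

/-- The exponential family conditioned on a set on which the statistic is bounded. -/
theorem isAdmissible_truncated [SigmaFinite ν] [FiniteDimensional ℝ E] (hT : Measurable T)
    (lam : E) {S : Set α} (hS : MeasurableSet S) (hS0 : ν S ≠ 0) (hSt : ν S ≠ ⊤) {R : ℝ}
    (hR : ∀ x ∈ S, ‖T x‖ ≤ R) :
    IsAdmissible ν T ((ν.restrict S).tilted fun x => T x lam) ∧
    lam ∈ domain (ν.restrict S) T ∧
    relEnt ((ν.restrict S).tilted fun x => T x lam) ν =
      (∫ x, T x ∂((ν.restrict S).tilted fun x => T x lam)) lam -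
        logPartition (ν.restrict S) T lam := by
  have hm := measurable_apply hT
  have hfin : IsFiniteMeasure (ν.restrict S) := ⟨by simpa using hSt.lt_top⟩
  have hne : NeZero (ν.restrict S) := ⟨by simpa [Measure.restrict_eq_zero] using hS0⟩
  have hRae : ∀ᵐ x ∂(ν.restrict S), ‖T x‖ ≤ R :=
    (ae_restrict_iff' hS).2 (ae_of_all _ hR)
  have hdom : lam ∈ domain (ν.restrict S) T := by
    refine Integrable.of_bound (hm lam).exp.aestronglyMeasurable (Real.exp (R * ‖lam‖)) ?_
    filter_upwards [hRae] with x hx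
    rw [Real.norm_of_nonneg (Real.exp_pos _).le, Real.exp_le_exp]
    exact (le_abs_self _).trans (((T x).le_opNorm lam).trans
      (mul_le_mul_of_nonneg_right hx (norm_nonneg _)))
  have hprob := isProbabilityMeasure_tilted hdom
  have hacS := tilted_absolutelyContinuous (ν.restrict S) (fun x => T x lam)
  have hint : Integrable T ((ν.restrict S).tilted fun x => T x lam) :=
    Integrable.of_bound hT.aestronglyMeasurable R (hacS.ae_le hRae)
  have hllr : llr ((ν.restrict S).tilted fun x => T x lam) ν
      =ᵐ[(ν.restrict S).tilted fun x => T x lam]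
      fun x => T x lam - logPartition (ν.restrict S) T lam := by
    refine hacS.ae_le ?_
    have hmeas : Measurable (S.indicator fun x => ENNReal.ofReal
        (Real.exp (T x lam) / ∫ x, Real.exp (T x lam) ∂(ν.restrict S))) :=
      ((hm lam).exp.div_const _).ennreal_ofReal.indicator hS
    have h1 := Measure.rnDeriv_withDensity ν hmeas
    rw [withDensity_indicator hS] at h1
    filter_upwards [ae_restrict_of_ae h1, ae_restrict_mem hS] with x hx hxS
    have hZ := partition_pos hdom
    rw [llr_def]
    simp only [Measure.tilted]
    rw [hx, indicator_of_mem hxS, ENNReal.toReal_ofReal (by positivity),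
      Real.log_div (Real.exp_ne_zero _) hZ.ne', Real.log_exp, logPartition]
  have hac : ((ν.restrict S).tilted fun x => T x lam) ≪ ν :=
    hacS.trans Measure.restrict_le_self.absolutelyContinuous
  refine ⟨⟨hprob, hac, ?_, hint⟩, hdom, ?_⟩
  · exact ((hint.apply_continuousLinearMap lam).sub (integrable_const _)).congr hllr.symm
  · rw [relEnt, integral_congr_ae hllr, integral_sub (hint.apply_continuousLinearMap lam)
      (integrable_const _), ContinuousLinearMap.integral_apply hint]
    simp

/-- A minimizer of the relative entropy minus a linear function of the moments satisfies the Gibbs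
variational inequality with equality. The competitors are truncations of the exponential family, so
that nothing has to be assumed about the parameter. -/
theorem IsAdmissible.relEnt_eq_of_minimal [SigmaFinite ν] [NeZero ν] [FiniteDimensional ℝ E]
    (hT : Measurable T) (hp : IsAdmissible ν T p)
    (hmin : ∀ q, IsAdmissible ν T q →
      relEnt p ν - (∫ x, T x ∂p) lam ≤ relEnt q ν - (∫ x, T x ∂q) lam) :
    lam ∈ domain ν T ∧ relEnt p ν = (∫ x, T x ∂p) lam - logPartition ν T lam := by
  have hm := measurable_apply hT
  set C := Real.exp ((∫ x, T x ∂p) lam - relEnt p ν)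
  set S : ℕ → Set α := fun n => spanningSets ν n ∩ {x | ‖T x‖ ≤ n}
  have hSm : ∀ n, MeasurableSet (S n) := fun n =>
    (measurableSet_spanningSets ν n).inter (hT.norm measurableSet_Iic)
  have hSfin : ∀ n, ν (S n) ≠ ⊤ := fun n =>
    ((measure_mono inter_subset_left).trans_lt (measure_spanningSets_lt_top ν n)).ne
  have hmono : Monotone S := fun i j hij => inter_subset_inter (monotone_spanningSets ν hij)
    fun x (hx : ‖T x‖ ≤ i) => hx.trans (Nat.cast_le.2 hij)
  have hun : ⋃ n, S n = univ := by
    refine eq_univ_of_forall fun x => ?_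
    obtain ⟨i, hi⟩ := mem_iUnion.1 ((iUnion_spanningSets ν).symm ▸ mem_univ x)
    obtain ⟨j, hj⟩ := exists_nat_ge ‖T x‖
    refine mem_iUnion.2 ⟨max i j, monotone_spanningSets ν (le_max_left i j) hi, ?_⟩
    exact hj.trans (Nat.cast_le.2 (le_max_right i j))
  have hbound : ∀ n, ∫⁻ x in S n, ENNReal.ofReal (Real.exp (T x lam)) ∂ν ≤ ENNReal.ofReal C := by
    intro n
    by_cases h0 : ν (S n) = 0
    · rw [Measure.restrict_eq_zero.2 h0, lintegral_zero_measure]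
      exact zero_le
    obtain ⟨hadm, hdom, hrel⟩ := isAdmissible_truncated hT lam (hSm n) h0 (hSfin n)
      (R := n) fun x hx => hx.2
    have hne : NeZero (ν.restrict (S n)) := ⟨by simpa [Measure.restrict_eq_zero] using h0⟩
    have h1 := hmin _ hadm
    rw [hrel] at h1
    rw [← ofReal_integral_eq_lintegral_ofReal hdom (ae_of_all _ fun x => (Real.exp_pos _).le),
      ← exp_logPartition hdom]
    exact ENNReal.ofReal_le_ofReal (Real.exp_le_exp.2 (by linarith))
  have htot : ∫⁻ x, ENNReal.ofReal (Real.exp (T x lam)) ∂ν ≤ ENNReal.ofReal C := by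
    rw [← Measure.restrict_univ (μ := ν), ← hun,
      setLIntegral_iUnion_of_directed _ hmono.directed_le]
    exact iSup_le hbound
  have hdom : lam ∈ domain ν T := (lintegral_ofReal_ne_top_iff_integrable
    (hm lam).exp.aestronglyMeasurable (ae_of_all _ fun x => (Real.exp_pos _).le)).1
    (htot.trans_lt ENNReal.ofReal_lt_top).ne
  refine ⟨hdom, le_antisymm ?_ (hp.le_relEnt hdom)⟩
  rw [← ofReal_integral_eq_lintegral_ofReal hdom (ae_of_all _ fun x => (Real.exp_pos _).le),
    ENNReal.ofReal_le_ofReal_iff (Real.exp_pos _).le, ← exp_logPartition hdom,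
    Real.exp_le_exp] at htot
  linarith

/-- Members of the exponential family are stationary points of the Lagrangian. -/
theorem hasDerivWithinAt_lagrangian_tilted [SigmaFinite ν] [NeZero ν] [FiniteDimensional ℝ E]
    (hT : Measurable T) (h : lam ∈ interior (domain ν T)) (hq : IsAdmissible ν T q) :
    HasDerivWithinAt (fun t => relEnt (ExpFamily.mixture (ν.tilted fun x => T x lam) q t) ν -
      (∫ x, T x ∂(ExpFamily.mixture (ν.tilted fun x => T x lam) q t)) lam) 0 (Ici 0) 0 := by
  have hp := isAdmissible_tilted hT h
  have h1 := (hasDerivWithinAt_relEnt_tilted hT h hq).sub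
    (hasDerivAt_chord (mean ν T lam lam) ((∫ x, T x ∂q) lam)).hasDerivWithinAt
  rw [sub_self] at h1
  have heq : ∀ t ∈ Icc (0 : ℝ) 1,
      (∫ x, T x ∂(ExpFamily.mixture (ν.tilted fun x => T x lam) q t)) lam =
        (1 - t) * mean ν T lam lam + t * (∫ x, T x ∂q) lam := by
    intro t ht
    rw [integral_mixture hp.integrable_stat hq.integrable_stat ht]
    simp [mean]
  refine h1.congr_of_eventuallyEq ?_ (by simp [mean])
  filter_upwards [Icc_mem_nhdsGE one_pos] with t ht
  simp only [Pi.sub_apply]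
  rw [heq t ht]

/-- Stationarity of the Lagrangian of the relative entropy forces equality in the Gibbs variational
inequality, by convexity. -/
theorem IsAdmissible.relEnt_eq_of_stationary [SigmaFinite ν] [NeZero ν] [FiniteDimensional ℝ E]
    (hT : Measurable T) (hp : IsAdmissible ν T p)
    (hst : ∀ q, IsAdmissible ν T q → HasDerivWithinAt (fun t =>
      relEnt (ExpFamily.mixture p q t) ν - (∫ x, T x ∂(ExpFamily.mixture p q t)) lam) 0 (Ici 0) 0) :
    lam ∈ domain ν T ∧ relEnt p ν = (∫ x, T x ∂p) lam - logPartition ν T lam := by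
  refine hp.relEnt_eq_of_minimal hT fun q hq => ?_
  have := hp.prob
  have := hq.prob
  have h1 := deriv_le_of_le_chord (hst q hq) (B := relEnt q ν - (∫ x, T x ∂q) lam) fun t ht => by
    have h2 := (relEnt_mixture_le hp.ac hq.ac hp.integrable_llr hq.integrable_llr ht).2
    rw [integral_mixture hp.integrable_stat hq.integrable_stat ht]
    simp only [mixture_zero, add_apply, smul_apply, smul_eq_mul]
    linarith
  simp only [mixture_zero] at h1
  linarith

end Variational

end ExpFamily
end

/-! ### The relaxed Bethe problem at fixed moments -/

noncomputable section

section Pairings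

/-- The inner product as a linear equivalence with the dual. -/
def innerPair (E : Type*) [NormedAddCommGroup E] [InnerProductSpace ℝ E] [FiniteDimensional ℝ E] :
    E ≃L[ℝ] StrongDual ℝ E :=
  LinearEquiv.toContinuousLinearEquiv
    { toFun := fun m => InnerProductSpace.toDual ℝ E m
      invFun := fun f => (InnerProductSpace.toDual ℝ E).symm f
      map_add' := fun a b => map_add _ a b
      map_smul' := fun r a => by
        ext v
        simp
      left_inv := fun m => by simp
      right_inv := fun f => by simp }

@[simp]
theorem innerPair_apply {E : Type*} [NormedAddCommGroup E] [InnerProductSpace ℝ E]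
    [FiniteDimensional ℝ E] (m l : E) : innerPair E m l = inner ℝ l m := by
  rw [real_inner_comm]
  rfl

/-- The sum of the inner products of the components as a linear equivalence between a finite product
(with the supremum norm) and its dual. -/
def piPair {ι : Type*} [Fintype ι] (E : ι → Type*) [∀ i, NormedAddCommGroup (E i)]
    [∀ i, InnerProductSpace ℝ (E i)] [∀ i, FiniteDimensional ℝ (E i)] :
    (∀ i, E i) ≃L[ℝ] StrongDual ℝ (∀ i, E i) := by
  classical
  exact LinearEquiv.toContinuousLinearEquiv
    { toFun := fun m => ∑ i, (innerPair (E i) (m i)).comp (ContinuousLinearMap.proj i)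
      invFun := fun f i => (innerPair (E i)).symm (f.comp (ContinuousLinearMap.single ℝ E i))
      map_add' := fun a b => by
        ext v
        simp [Finset.sum_add_distrib]
      map_smul' := fun r a => by
        ext v
        simp [Finset.mul_sum]
      left_inv := fun m => by
        ext1 i
        rw [ContinuousLinearEquiv.symm_apply_eq]
        ext v
        simp only [ContinuousLinearMap.comp_apply, sum_apply,
          ContinuousLinearMap.proj_apply, ContinuousLinearMap.single_apply, innerPair_apply]
        rw [Finset.sum_eq_single i (fun j _ hj => by simp [Pi.single_eq_of_ne hj])
          (fun h => absurd (Finset.mem_univ i) h)]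
        simp
      right_inv := fun f => by
        ext v
        simp only [sum_apply, ContinuousLinearMap.comp_apply,
          ContinuousLinearMap.proj_apply, ContinuousLinearEquiv.apply_symm_apply,
          ContinuousLinearMap.single_apply]
        rw [← map_sum, Finset.univ_sum_single] }

@[simp]
theorem piPair_apply {ι : Type*} [Fintype ι] {E : ι → Type*} [∀ i, NormedAddCommGroup (E i)]
    [∀ i, InnerProductSpace ℝ (E i)] [∀ i, FiniteDimensional ℝ (E i)] (m l : ∀ i, E i) :
    piPair E m l = ∑ i, inner ℝ (l i) (m i) := by
  change (∑ i, (innerPair (E i) (m i)).comp (ContinuousLinearMap.proj i)) l = _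
  simp

theorem EReal.coe_finsetSum {ι : Type*} (s : Finset ι) (f : ι → ℝ) :
    ((∑ i ∈ s, f i : ℝ) : EReal) = ∑ i ∈ s, (f i : EReal) := by
  classical
  induction s using Finset.induction_on with
  | empty => simp
  | insert a s ha ih => rw [Finset.sum_insert ha, Finset.sum_insert ha, EReal.coe_add, ih]

end Pairings

namespace TreeModel

open ExpFamily

variable {V F : Type*} (M : TreeModel V F)

instance (k : F) : SigmaFinite (M.f k) := M.sigmaFinite_f k

instance (k : F) : NeZero (M.f k) := ⟨M.f_ne_zero k⟩

/-- The sufficient statistic of the variable `i`, as a functional of the natural parameter. -/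
def varStat (i : V) (x : M.X i) : StrongDual ℝ (M.P i) := innerPair (M.P i) (M.φ i x)

/-- The sufficient statistics of the arguments of the factor `k`, as a functional of the natural
parameter. -/
def facStat (k : F) (x : M.XF k) : StrongDual ℝ (M.PF k) :=
  piPair (fun i : M.nbr k => M.P i) fun i => M.φ i (x i)

theorem varStat_apply (i : V) (x : M.X i) (lam : M.P i) :
    M.varStat i x lam = M.varEnergy i lam x := innerPair_apply _ _

theorem facStat_apply (k : F) (x : M.XF k) (lam : M.PF k) :
    M.facStat k x lam = M.facEnergy k lam x := piPair_apply _ _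

theorem measurable_varStat (i : V) : Measurable (M.varStat i) :=
  (innerPair (M.P i)).continuous.measurable.comp (M.measurable_φ i)

theorem measurable_facStat (k : F) : Measurable (M.facStat k) :=
  (piPair (fun i : M.nbr k => M.P i)).continuous.measurable.comp
    (measurable_pi_lambda _ fun i => (M.measurable_φ i).comp (measurable_pi_apply i))

theorem varDomain_eq (i : V) : M.varDomain i = domain volume (M.varStat i) := by
  simp only [varDomain, domain, varStat_apply]

theorem facDomain_eq (k : F) : M.facDomain k = domain (M.f k) (M.facStat k) := by
  simp only [facDomain, domain, facStat_apply]

theorem varLogPartition_eq (i : V) : M.varLogPartition i = logPartition volume (M.varStat i) := by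
  ext lam
  simp only [varLogPartition, logPartition, varStat_apply]

theorem facLogPartition_eq (k : F) :
    M.facLogPartition k = logPartition (M.f k) (M.facStat k) := by
  ext lam
  simp only [facLogPartition, logPartition, facStat_apply]

theorem varMarginal_eq (i : V) (lam : M.P i) :
    M.varMarginal i lam = (volume : Measure (M.X i)).tilted fun x => M.varStat i x lam := by
  simp only [varMarginal, varStat_apply]

theorem facMarginal_eq (k : F) (lam : M.PF k) :
    M.facMarginal k lam = (M.f k).tilted fun x => M.facStat k x lam := by
  simp only [facMarginal, facStat_apply]

theorem integrable_varStat_iff {i : V} {p : Measure (M.X i)} :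
    Integrable (M.varStat i) p ↔ Integrable (M.φ i) p :=
  (innerPair (M.P i)).integrable_comp_iff

theorem integrable_facStat_iff {k : F} {p : Measure (M.XF k)} :
    Integrable (M.facStat k) p ↔
      ∀ i : M.nbr k, Integrable (fun x : M.XF k => M.φ i (x i)) p :=
  (piPair (fun i : M.nbr k => M.P i)).integrable_comp_iff.trans integrable_pi_iff

theorem integral_varStat (i : V) (p : Measure (M.X i)) :
    ∫ x, M.varStat i x ∂p = innerPair (M.P i) (∫ x, M.φ i x ∂p) :=
  (innerPair (M.P i)).integral_comp_comm _

theorem integral_facStat {k : F} {p : Measure (M.XF k)} (h : Integrable (M.facStat k) p) :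
    ∫ x, M.facStat k x ∂p =
      piPair (fun i : M.nbr k => M.P i) fun i => ∫ x, M.φ i (x i) ∂p := by
  refine ((piPair (fun i : M.nbr k => M.P i)).integral_comp_comm _).trans ?_
  congr 1
  ext1 i
  exact eval_integral (M.integrable_facStat_iff.1 h) i

theorem mean_varStat (i : V) (lam : M.P i) :
    mean volume (M.varStat i) lam = innerPair (M.P i) (M.varMoment i lam) := by
  rw [varMoment, varMarginal_eq, ← integral_varStat, mean]

theorem mean_facStat {k : F} {lam : M.PF k} (h : lam ∈ interior (M.facDomain k)) :
    mean (M.f k) (M.facStat k) lam =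
      piPair (fun i : M.nbr k => M.P i) (M.facMoment k lam) := by
  rw [facDomain_eq] at h
  rw [mean, M.integral_facStat (integrable_tilted (M.measurable_facStat k) h), ← facMarginal_eq]
  rfl

theorem varGibbs_eq (i : V) (m : M.P i) :
    M.varGibbs i m = legendre volume (M.varStat i) (innerPair (M.P i) m) := by
  simp only [varGibbs, legendre, varDomain_eq, varLogPartition_eq, innerPair_apply]

theorem facGibbs_eq (k : F) (m : M.PF k) :
    M.facGibbs k m = legendre (M.f k) (M.facStat k) (piPair (fun i : M.nbr k => M.P i) m) := by
  simp only [facGibbs, legendre, facDomain_eq, facLogPartition_eq, piPair_apply]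

theorem varGibbs_varMoment {i : V} {lam : M.P i} (h : lam ∈ interior (M.varDomain i)) :
    M.varGibbs i (M.varMoment i lam) =
      ((inner ℝ lam (M.varMoment i lam) - M.varLogPartition i lam : ℝ) : EReal) := by
  rw [varDomain_eq] at h
  rw [varGibbs_eq, ← mean_varStat, legendre_mean (M.measurable_varStat i) h, mean_varStat,
    innerPair_apply, varLogPartition_eq]

theorem facGibbs_facMoment {k : F} {lam : M.PF k} (h : lam ∈ interior (M.facDomain k)) :
    M.facGibbs k (M.facMoment k lam) =
      ((piPair (fun i : M.nbr k => M.P i) (M.facMoment k lam) lam - M.facLogPartition k lam : ℝ) :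
        EReal) := by
  rw [facGibbs_eq, ← M.mean_facStat h, legendre_mean (M.measurable_facStat k)
    (M.facDomain_eq k ▸ h), facLogPartition_eq]

theorem flat_varStat {M : TreeModel V F} (hmin : M.VariableMinimal) (i : V) :
    flat volume (M.varStat i) = ⊥ := by
  rw [eq_bot_iff]
  rintro a ⟨c, hc⟩
  refine hmin i a c ?_
  filter_upwards [hc] with x hx
  rwa [varStat_apply] at hx

section Admissible

variable {M}

theorem Beliefs.Admissible.var {b : M.Beliefs} (h : b.Admissible) (i : V) :
    IsAdmissible volume (M.varStat i) (b.pV i) :=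
  ⟨h.prob_V i, h.ac_V i, h.integrable_llr_V i, M.integrable_varStat_iff.2 (h.integrable_φ_V i)⟩

theorem Beliefs.Admissible.fac {b : M.Beliefs} (h : b.Admissible) (k : F) :
    IsAdmissible (M.f k) (M.facStat k) (b.pF k) :=
  ⟨h.prob_F k, h.ac_F k, h.integrable_llr_F k, M.integrable_facStat_iff.2 (h.integrable_φ_F k)⟩

theorem Beliefs.admissible_of {b : M.Beliefs}
    (hV : ∀ i, IsAdmissible volume (M.varStat i) (b.pV i))
    (hF : ∀ k, IsAdmissible (M.f k) (M.facStat k) (b.pF k)) : b.Admissible :=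
  ⟨fun i => (hV i).prob, fun k => (hF k).prob, fun i => (hV i).ac, fun k => (hF k).ac,
    fun i => (hV i).integrable_llr, fun k => (hF k).integrable_llr,
    fun i => M.integrable_varStat_iff.1 (hV i).integrable_stat,
    fun k => M.integrable_facStat_iff.1 (hF k).integrable_stat⟩

theorem Beliefs.Admissible.mix {b b' : M.Beliefs} (h : b.Admissible) (h' : b'.Admissible) {t : ℝ}
    (ht : t ∈ Icc (0 : ℝ) 1) : (b.mix b' t).Admissible :=
  Beliefs.admissible_of (fun i => (h.var i).mixture (h'.var i) ht)
    fun k => (h.fac k).mixture (h'.fac k) ht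

theorem Beliefs.integral_varStat (b : M.Beliefs) (i : V) :
    ∫ x, M.varStat i x ∂(b.pV i) = innerPair (M.P i) (b.momentV i) :=
  M.integral_varStat i _

theorem Beliefs.Admissible.integral_facStat {b : M.Beliefs} (h : b.Admissible) (k : F) :
    ∫ x, M.facStat k x ∂(b.pF k) = piPair (fun i : M.nbr k => M.P i) (b.momentF k) :=
  M.integral_facStat (h.fac k).integrable_stat

end Admissible

/-- Every variable is an argument of some factor, since the factor graph is connected and has a
factor node. -/
theorem one_le_n [DecidableEq V] [Fintype F] [Nonempty F] (i : V) : 1 ≤ M.n i := by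
  have : Nontrivial (V ⊕ F) := ⟨.inl i, .inr (Classical.arbitrary F), by simp⟩
  obtain ⟨u, hu⟩ := M.isTree.connected.preconnected.exists_adj_of_nontrivial (Sum.inl i)
  rw [factorGraph, SimpleGraph.fromRel_adj] at hu
  rcases u with j | k
  · simp at hu
  · rw [n, Nat.one_le_iff_ne_zero, ← Nat.pos_iff_ne_zero, Fintype.card_pos_iff]
    exact ⟨⟨k, by simpa using hu⟩⟩

variable [Fintype V] [DecidableEq V] [Fintype F]

theorem gibbsFreeEnergy_eq_coe {mu : M.VarParams} {a : F → ℝ} {c : V → ℝ}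
    (hF : ∀ k, M.facGibbs k (M.restrict mu k) = (a k : EReal))
    (hV : ∀ i, M.n i ≠ 1 → M.varGibbs i (mu i) = (c i : EReal)) :
    M.gibbsFreeEnergy mu = ((∑ k, a k + ∑ i, (1 - (M.n i : ℝ)) * c i : ℝ) : EReal) := by
  rw [gibbsFreeEnergy, EReal.coe_add, EReal.coe_finsetSum, EReal.coe_finsetSum]
  congr 1
  · exact Finset.sum_congr rfl fun k _ => hF k
  · refine Finset.sum_congr rfl fun i _ => ?_
    by_cases hi : M.n i = 1
    · simp [hi]
    · rw [hV i hi, EReal.coe_mul]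

/-- The Lagrangian is a sum of separate terms, one for each belief. -/
theorem betheLagrangian_eq (mu lamV : M.VarParams) (lamF : M.FacParams) {b : M.Beliefs}
    (hb : b.Admissible) : M.betheLagrangian mu lamV lamF b =
      ∑ k, (relEnt (b.pF k) (M.f k) - (∫ x, M.facStat k x ∂(b.pF k)) (lamF k)) +
      ∑ i, (1 - (M.n i : ℝ)) *
        (relEnt (b.pV i) volume - (∫ x, M.varStat i x ∂(b.pV i)) (lamV i)) +
      (∑ k, ∑ i : M.nbr k, inner ℝ (lamF k i) (mu i) +
        ∑ i, (1 - (M.n i : ℝ)) * inner ℝ (lamV i) (mu i)) := by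
  simp only [betheLagrangian, betheFreeEnergy, hb.integral_facStat, b.integral_varStat,
    piPair_apply, innerPair_apply, inner_sub_right, Finset.sum_sub_distrib, mul_sub]
  ring

/-- At moments dual to natural parameters, the exponential families solve the relaxed Bethe
problem, with the natural parameters as multipliers. -/
theorem exists_isBetheStationaryAt {mu : M.VarParams} (hmu : mu ∈ M.momentDomain) :
    ∃ b, M.IsBetheStationaryAt mu b := by
  obtain ⟨hV, hF⟩ := hmu
  choose lamV hlV hmV using hV
  choose lamF hlF hmF using hF
  have hlV' : ∀ i, lamV i ∈ interior (domain volume (M.varStat i)) := fun i =>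
    M.varDomain_eq i ▸ hlV i
  have hlF' : ∀ k, lamF k ∈ interior (domain (M.f k) (M.facStat k)) := fun k =>
    M.facDomain_eq k ▸ hlF k
  let b : M.Beliefs := ⟨fun i => M.varMarginal i (lamV i), fun k => M.facMarginal k (lamF k)⟩
  have hb : b.Admissible := by
    refine Beliefs.admissible_of (fun i => ?_) fun k => ?_
    · simp only [b, varMarginal_eq]
      exact isAdmissible_tilted (M.measurable_varStat i) (hlV' i)
    · simp only [b, facMarginal_eq]
      exact isAdmissible_tilted (M.measurable_facStat k) (hlF' k)
  refine ⟨b, hb, ⟨hmV, hmF⟩, lamV, lamF, fun b' hb' => ?_⟩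
  have hderiv : HasDerivWithinAt (fun t => ∑ k, (relEnt ((b.mix b' t).pF k) (M.f k) -
      (∫ x, M.facStat k x ∂((b.mix b' t).pF k)) (lamF k)) +
      ∑ i, (1 - (M.n i : ℝ)) * (relEnt ((b.mix b' t).pV i) volume -
        (∫ x, M.varStat i x ∂((b.mix b' t).pV i)) (lamV i)) +
      (∑ k, ∑ i : M.nbr k, inner ℝ (lamF k i) (mu i) +
        ∑ i, (1 - (M.n i : ℝ)) * inner ℝ (lamV i) (mu i))) 0 (Ici 0) 0 := by
    have h1 : ∀ k, HasDerivWithinAt (fun t => relEnt ((b.mix b' t).pF k) (M.f k) -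
        (∫ x, M.facStat k x ∂((b.mix b' t).pF k)) (lamF k)) 0 (Ici 0) 0 := fun k => by
      have := hasDerivWithinAt_lagrangian_tilted (M.measurable_facStat k) (hlF' k) (hb'.fac k)
      rwa [← facMarginal_eq] at this
    have h2 : ∀ i, HasDerivWithinAt (fun t => relEnt ((b.mix b' t).pV i) volume -
        (∫ x, M.varStat i x ∂((b.mix b' t).pV i)) (lamV i)) 0 (Ici 0) 0 := fun i => by
      have := hasDerivWithinAt_lagrangian_tilted (M.measurable_varStat i) (hlV' i) (hb'.var i)
      rwa [← varMarginal_eq] at this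
    have h3 := ((HasDerivWithinAt.fun_sum fun k (_ : k ∈ Finset.univ) => h1 k).fun_add
      (HasDerivWithinAt.fun_sum fun i (_ : i ∈ Finset.univ) =>
        (h2 i).const_mul (1 - (M.n i : ℝ)))).add_const
      (∑ k, ∑ i : M.nbr k, inner ℝ (lamF k i) (mu i) +
        ∑ i, (1 - (M.n i : ℝ)) * inner ℝ (lamV i) (mu i))
    simpa using h3
  refine hderiv.congr_of_eventuallyEq ?_ (M.betheLagrangian_eq mu lamV lamF (hb.mix hb' (by simp)))
  filter_upwards [Icc_mem_nhdsGE one_pos] with t ht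
  exact M.betheLagrangian_eq mu lamV lamF (hb.mix hb' ht)

/-- Varying a single factor belief in the Lagrangian determines its entropy. -/
theorem relEnt_fac_of_stationary {mu : M.VarParams} {b : M.Beliefs} {lamV : M.VarParams}
    {lamF : M.FacParams} (hb : b.Admissible)
    (hst : ∀ b' : M.Beliefs, b'.Admissible →
      HasDerivWithinAt (fun t => M.betheLagrangian mu lamV lamF (b.mix b' t)) 0 (Ici 0) 0) (k : F) :
    lamF k ∈ domain (M.f k) (M.facStat k) ∧ relEnt (b.pF k) (M.f k) =
      (∫ x, M.facStat k x ∂(b.pF k)) (lamF k) - logPartition (M.f k) (M.facStat k) (lamF k) := by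
  classical
  refine (hb.fac k).relEnt_eq_of_stationary (M.measurable_facStat k) fun q hq => ?_
  let b' : M.Beliefs := ⟨b.pV, Function.update b.pF k q⟩
  have hbk : b'.pF k = q := by simp [b']
  have hbj : ∀ j, j ≠ k → b'.pF j = b.pF j := fun j hj => by simp [b', hj]
  have hb' : b'.Admissible := Beliefs.admissible_of (fun i => hb.var i) fun j => by
    rcases eq_or_ne j k with rfl | hj
    · rwa [hbk]
    · rw [hbj j hj]; exact hb.fac j
  have key : ∀ t ∈ Icc (0 : ℝ) 1, relEnt (mixture (b.pF k) q t) (M.f k) -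
      (∫ x, M.facStat k x ∂(mixture (b.pF k) q t)) (lamF k) =
      M.betheLagrangian mu lamV lamF (b.mix b' t) + (relEnt (b.pF k) (M.f k) -
      (∫ x, M.facStat k x ∂(b.pF k)) (lamF k) - M.betheLagrangian mu lamV lamF b) := by
    intro t ht
    have e1 : (b.mix b' t).pF k = mixture (b.pF k) q t := by
      rw [← hbk]; rfl
    have e2 : ∀ j ∈ Finset.univ.erase k, relEnt ((b.mix b' t).pF j) (M.f j) -
        (∫ x, M.facStat j x ∂((b.mix b' t).pF j)) (lamF j) = relEnt (b.pF j) (M.f j) -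
        (∫ x, M.facStat j x ∂(b.pF j)) (lamF j) := by
      intro j hj
      have : (b.mix b' t).pF j = mixture (b.pF j) (b'.pF j) t := rfl
      rw [this, hbj j (Finset.ne_of_mem_erase hj), mixture_self ht]
    have e3 : ∀ i, (b.mix b' t).pV i = b.pV i := fun i => mixture_self ht
    rw [M.betheLagrangian_eq mu lamV lamF (hb.mix hb' ht), M.betheLagrangian_eq mu lamV lamF hb,
      ← Finset.add_sum_erase _ _ (Finset.mem_univ k), Finset.sum_congr rfl e2, e1,
      ← Finset.add_sum_erase (f := fun j => relEnt (b.pF j) (M.f j) -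
        (∫ x, M.facStat j x ∂(b.pF j)) (lamF j)) _ (Finset.mem_univ k)]
    simp only [e3]
    ring
  have h1 := (hst b' hb').add_const (relEnt (b.pF k) (M.f k) -
      (∫ x, M.facStat k x ∂(b.pF k)) (lamF k) - M.betheLagrangian mu lamV lamF b)
  refine h1.congr_of_eventuallyEq ?_ (key 0 (by simp))
  filter_upwards [Icc_mem_nhdsGE one_pos] with t ht
  exact key t ht

/-- Varying a single variable belief in the Lagrangian determines its entropy, unless its coefficient
`1 - n_i` vanishes. -/
theorem relEnt_var_of_stationary {mu : M.VarParams} {b : M.Beliefs} {lamV : M.VarParams}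
    {lamF : M.FacParams} (hb : b.Admissible)
    (hst : ∀ b' : M.Beliefs, b'.Admissible →
      HasDerivWithinAt (fun t => M.betheLagrangian mu lamV lamF (b.mix b' t)) 0 (Ici 0) 0)
    {i : V} (hi : M.n i ≠ 1) :
    lamV i ∈ domain volume (M.varStat i) ∧ relEnt (b.pV i) volume =
      (∫ x, M.varStat i x ∂(b.pV i)) (lamV i) - logPartition volume (M.varStat i) (lamV i) := by
  refine (hb.var i).relEnt_eq_of_stationary (M.measurable_varStat i) fun q hq => ?_
  have hc : (1 - (M.n i : ℝ)) ≠ 0 := sub_ne_zero.2 fun h => hi (by exact_mod_cast h.symm)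
  let b' : M.Beliefs := ⟨Function.update b.pV i q, b.pF⟩
  have hbi : b'.pV i = q := by simp [b']
  have hbj : ∀ j, j ≠ i → b'.pV j = b.pV j := fun j hj => by simp [b', hj]
  have hb' : b'.Admissible := Beliefs.admissible_of (fun j => by
    rcases eq_or_ne j i with rfl | hj
    · rwa [hbi]
    · rw [hbj j hj]; exact hb.var j) fun k => hb.fac k
  have key : ∀ t ∈ Icc (0 : ℝ) 1, relEnt (mixture (b.pV i) q t) volume -
      (∫ x, M.varStat i x ∂(mixture (b.pV i) q t)) (lamV i) =
      (1 - (M.n i : ℝ))⁻¹ * (M.betheLagrangian mu lamV lamF (b.mix b' t) +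
      ((1 - (M.n i : ℝ)) * (relEnt (b.pV i) volume -
      (∫ x, M.varStat i x ∂(b.pV i)) (lamV i)) - M.betheLagrangian mu lamV lamF b)) := by
    intro t ht
    have e1 : (b.mix b' t).pV i = mixture (b.pV i) q t := by
      rw [← hbi]; rfl
    have e2 : ∀ j ∈ Finset.univ.erase i, (1 - (M.n j : ℝ)) *
        (relEnt ((b.mix b' t).pV j) volume -
        (∫ x, M.varStat j x ∂((b.mix b' t).pV j)) (lamV j)) = (1 - (M.n j : ℝ)) *
        (relEnt (b.pV j) volume - (∫ x, M.varStat j x ∂(b.pV j)) (lamV j)) := by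
      intro j hj
      have : (b.mix b' t).pV j = mixture (b.pV j) (b'.pV j) t := rfl
      rw [this, hbj j (Finset.ne_of_mem_erase hj), mixture_self ht]
    have e3 : ∀ k, (b.mix b' t).pF k = b.pF k := fun k => mixture_self ht
    rw [eq_inv_mul_iff_mul_eq₀ hc, M.betheLagrangian_eq mu lamV lamF (hb.mix hb' ht),
      M.betheLagrangian_eq mu lamV lamF hb,
      ← Finset.add_sum_erase (f := fun j => (1 - (M.n j : ℝ)) *
        (relEnt ((b.mix b' t).pV j) volume -
        (∫ x, M.varStat j x ∂((b.mix b' t).pV j)) (lamV j))) _ (Finset.mem_univ i),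
      Finset.sum_congr rfl e2, e1,
      ← Finset.add_sum_erase (f := fun j => (1 - (M.n j : ℝ)) * (relEnt (b.pV j) volume -
        (∫ x, M.varStat j x ∂(b.pV j)) (lamV j))) _ (Finset.mem_univ i)]
    simp only [e3]
    ring
  have h1 := ((hst b' hb').add_const ((1 - (M.n i : ℝ)) * (relEnt (b.pV i) volume -
      (∫ x, M.varStat i x ∂(b.pV i)) (lamV i)) - M.betheLagrangian mu lamV lamF b)).const_mul
      (1 - (M.n i : ℝ))⁻¹
  rw [mul_zero] at h1
  refine h1.congr_of_eventuallyEq ?_ (key 0 (by simp))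
  filter_upwards [Icc_mem_nhdsGE one_pos] with t ht
  exact key t ht

/-- The entropies of a solution are the Legendre transforms at its moments. -/
theorem gibbs_eq_of_stationary {mu : M.VarParams} {b : M.Beliefs}
    (h : M.IsBetheStationaryAt mu b) :
    (∀ k, M.facGibbs k (M.restrict mu k) = (relEnt (b.pF k) (M.f k) : EReal)) ∧
      ∀ i, M.n i ≠ 1 → M.varGibbs i (mu i) = (relEnt (b.pV i) volume : EReal) := by
  obtain ⟨hb, ⟨hmV, hmF⟩, lamV, lamF, hst⟩ := h
  refine ⟨fun k => ?_, fun i hi => ?_⟩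
  · obtain ⟨h1, h2⟩ := M.relEnt_fac_of_stationary hb hst k
    rw [facGibbs_eq, ← hmF k, ← hb.integral_facStat]
    refine le_antisymm (hb.fac k).legendre_le ?_
    rw [h2]
    exact le_legendre h1 _
  · obtain ⟨h1, h2⟩ := M.relEnt_var_of_stationary hb hst hi
    rw [varGibbs_eq, ← hmV i, ← b.integral_varStat]
    refine le_antisymm (hb.var i).legendre_le ?_
    rw [h2]
    exact le_legendre h1 _

theorem betheFreeEnergy_eq_gibbs {mu : M.VarParams} {b : M.Beliefs}
    (h : M.IsBetheStationaryAt mu b) :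
    (M.betheFreeEnergy b : EReal) = M.gibbsFreeEnergy mu := by
  obtain ⟨hF, hV⟩ := M.gibbs_eq_of_stationary h
  exact (M.gibbsFreeEnergy_eq_coe hF hV).symm

/-- A solution is a saddle point among the beliefs with the same moments: its entropies relative to
the base measures are minimal, and those of the variables enter with nonpositive coefficients. -/
theorem bethe_saddle [Nonempty F] {mu : M.VarParams} {b b' : M.Beliefs}
    (h : M.IsBetheStationaryAt mu b) (hb' : b'.Admissible) (hmom : b'.HasMoments mu) :
    M.betheFreeEnergy b ≤ M.betheFreeEnergy ⟨b.pV, b'.pF⟩ ∧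
      M.betheFreeEnergy ⟨b'.pV, b.pF⟩ ≤ M.betheFreeEnergy b := by
  obtain ⟨hF, hV⟩ := M.gibbs_eq_of_stationary h
  constructor
  · refine add_le_add_left (Finset.sum_le_sum fun k _ => ?_) _
    have h1 := (hb'.fac k).legendre_le
    rw [hb'.integral_facStat, hmom.2 k, ← facGibbs_eq, hF k] at h1
    exact EReal.coe_le_coe_iff.1 h1
  · refine add_le_add_right (Finset.sum_le_sum fun i _ => ?_) _
    by_cases hi : M.n i = 1
    · simp [hi]
    · have h1 := (hb'.var i).legendre_le
      rw [b'.integral_varStat, hmom.1 i, ← varGibbs_eq, hV i hi] at h1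
      refine mul_le_mul_of_nonpos_left (EReal.coe_le_coe_iff.1 h1) (sub_nonpos.2 ?_)
      exact_mod_cast M.one_le_n i

end TreeModel
end

/-! ### Infimal convolutions of log-partition functions -/

noncomputable section

namespace ExpFamily

variable {κ : Type*} [Fintype κ] {α : κ → Type*} [∀ k, MeasurableSpace (α k)]
  {E : κ → Type*} [∀ k, NormedAddCommGroup (E k)] [∀ k, NormedSpace ℝ (E k)]
  {W : Type*} [NormedAddCommGroup W] [NormedSpace ℝ W]

/-- The epigraph of the infimal convolution of the log-partition functions of finitely many families
along a linear map `G`, that is, of `ξ ↦ inf {∑ A_k(l_k) | G l = ξ}`. -/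
def convEpigraph (ν : ∀ k, Measure (α k)) (T : ∀ k, α k → StrongDual ℝ (E k))
    (G : (∀ k, E k) →ₗ[ℝ] W) : Set (W × ℝ) :=
  {p | ∃ l, (∀ k, l k ∈ domain (ν k) (T k)) ∧ G l = p.1 ∧
    ∑ k, logPartition (ν k) (T k) (l k) ≤ p.2}

variable {ν : ∀ k, Measure (α k)} {T : ∀ k, α k → StrongDual ℝ (E k)} {G : (∀ k, E k) →ₗ[ℝ] W}

theorem convex_convEpigraph [∀ k, NeZero (ν k)] (hT : ∀ k, Measurable (T k)) :
    Convex ℝ (convEpigraph ν T G) := by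
  rintro ⟨ξ, s⟩ ⟨l, hl, hξ, hs⟩ ⟨ξ', s'⟩ ⟨l', hl', hξ', hs'⟩ a b ha hb hab
  have h := fun k => logPartition_combo (measurable_apply (hT k)) (hl k) (hl' k) ha hb hab
  refine ⟨a • l + b • l', fun k => (h k).1, ?_, ?_⟩
  · simp only at hξ hξ'
    simp [hξ, hξ']
  · calc ∑ k, logPartition (ν k) (T k) ((a • l + b • l') k)
        ≤ ∑ k, (a * logPartition (ν k) (T k) (l k) + b * logPartition (ν k) (T k) (l' k)) :=
          Finset.sum_le_sum fun k _ => (h k).2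
      _ = a * ∑ k, logPartition (ν k) (T k) (l k) + b * ∑ k, logPartition (ν k) (T k) (l' k) := by
          rw [Finset.sum_add_distrib, Finset.mul_sum, Finset.mul_sum]
      _ ≤ a * s + b * s' := add_le_add (mul_le_mul_of_nonneg_left hs ha)
          (mul_le_mul_of_nonneg_left hs' hb)

/-- A bound on a sum of independent concave conjugate expressions bounds the sum of the suprema. -/
theorem exists_legendre_eq_of_sum_le (hne : ∀ k, (domain (ν k) (T k)).Nonempty)
    {m : ∀ k, StrongDual ℝ (E k)} {B : ℝ}
    (hB : ∀ l : ∀ k, E k, (∀ k, l k ∈ domain (ν k) (T k)) →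
      ∑ k, (m k (l k) - logPartition (ν k) (T k) (l k)) ≤ B) :
    ∃ a : κ → ℝ, (∀ k, legendre (ν k) (T k) (m k) = (a k : EReal)) ∧ ∑ k, a k ≤ B := by
  classical
  choose l₀ hl₀ using hne
  have hupd : ∀ k, ∀ v ∈ domain (ν k) (T k), ∀ j,
      Function.update l₀ k v j ∈ domain (ν j) (T j) := by
    intro k v hv j
    rcases eq_or_ne j k with rfl | hj
    · simpa using hv
    · simpa [hj] using hl₀ j
  have hfin : ∀ k, legendre (ν k) (T k) (m k) ≠ ⊤ := by
    intro k
    refine ne_top_of_le_ne_top (EReal.coe_ne_top (B - ∑ j ∈ Finset.univ.erase k,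
      (m j (l₀ j) - logPartition (ν j) (T j) (l₀ j)))) (legendre_le_iff.2 fun v hv => ?_)
    have h1 := hB _ (hupd k v hv)
    rw [← Finset.add_sum_erase _ _ (Finset.mem_univ k), Finset.sum_congr rfl
      (g := fun j => m j (l₀ j) - logPartition (ν j) (T j) (l₀ j)) fun j hj => by
        rw [Function.update_of_ne (Finset.ne_of_mem_erase hj)]] at h1
    rw [Function.update_self] at h1
    linarith
  have hcoe := fun k => coe_toReal_legendre ⟨l₀ k, hl₀ k⟩ (hfin k)
  refine ⟨fun k => (legendre (ν k) (T k) (m k)).toReal, fun k => (hcoe k).symm, ?_⟩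
  refine le_of_forall_pos_le_add fun ε hε => ?_
  set δ := ε / (Fintype.card κ + 1)
  have hδ : 0 < δ := by positivity
  have hex : ∀ k, ∃ l ∈ domain (ν k) (T k), (legendre (ν k) (T k) (m k)).toReal - δ <
      m k l - logPartition (ν k) (T k) l := by
    intro k
    by_contra hcon
    push Not at hcon
    have := legendre_le_iff.2 hcon
    rw [← hcoe k, EReal.coe_le_coe_iff] at this
    simp only [EReal.toReal_coe] at this
    linarith
  choose l hl hlt using hex
  have h1 : ∑ k, ((legendre (ν k) (T k) (m k)).toReal - δ) ≤ B :=
    (Finset.sum_le_sum fun k _ => (hlt k).le).trans (hB l hl)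
  rw [Finset.sum_sub_distrib, Finset.sum_const, Finset.card_univ, nsmul_eq_mul] at h1
  have h2 : Fintype.card κ * δ ≤ ε := by
    simp only [δ]
    rw [mul_div_assoc', div_le_iff₀ (by positivity)]
    nlinarith
  linarith

variable [∀ k, FiniteDimensional ℝ (E k)] {l₀ : ∀ k, E k} {μ₀ : StrongDual ℝ W}

/-- Weak duality at the means of interior parameters, in Fenchel's form. -/
theorem sub_sum_logPartition_le [∀ k, NeZero (ν k)] (hT : ∀ k, Measurable (T k))
    (h₀ : ∀ k, l₀ k ∈ interior (domain (ν k) (T k)))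
    (hμ : ∀ l, ∑ k, mean (ν k) (T k) (l₀ k) (l k) = μ₀ (G l)) {l : ∀ k, E k}
    (hl : ∀ k, l k ∈ domain (ν k) (T k)) :
    μ₀ (G l) - ∑ k, logPartition (ν k) (T k) (l k) ≤
      μ₀ (G l₀) - ∑ k, logPartition (ν k) (T k) (l₀ k) := by
  rw [← hμ, ← hμ, ← Finset.sum_sub_distrib, ← Finset.sum_sub_distrib]
  refine Finset.sum_le_sum fun k _ => ?_
  have := bregman_nonneg (hT k) (h₀ k) (hl k)
  rw [map_sub] at this
  linarith

/-- The infimal convolution is closed as soon as some moments compatible with `G` are the means of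
interior parameters: minimizing sequences are then bounded up to directions of constant energy. -/
theorem isClosed_convEpigraph [FiniteDimensional ℝ W] [∀ k, NeZero (ν k)]
    (hT : ∀ k, Measurable (T k)) (h₀ : ∀ k, l₀ k ∈ interior (domain (ν k) (T k)))
    (hμ : ∀ l, ∑ k, mean (ν k) (T k) (l₀ k) (l k) = μ₀ (G l)) :
    IsClosed (convEpigraph ν T G) := by
  choose K hK using fun k => (flat (ν k) (T k)).exists_isCompl
  choose η hη hco using fun k => exists_coercive (hT k) (h₀ k) (hK k).disjoint one_pos
  set N : Submodule ℝ (∀ k, E k) := Submodule.pi univ fun k => flat (ν k) (T k)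
  have hGc : Continuous G := G.continuous_of_finiteDimensional
  refine IsSeqClosed.isClosed fun x p hx hp => ?_
  choose l hl hGl hA using hx
  -- Split each parameter into a flat direction and a transversal displacement from `l₀`.
  have hdec : ∀ n k, ∃ a ∈ flat (ν k) (T k), ∃ h ∈ K k, a + h = l n k - l₀ k := fun n k =>
    Submodule.mem_sup.1 ((hK k).sup_eq_top ▸ Submodule.mem_top)
  choose a ha h hh hah using hdec
  have hl_eq : ∀ n k, l n k = l₀ k + h n k + a n k := fun n k => by
    rw [add_assoc, add_comm (h n k), hah]
    abel
  have hdom : ∀ n k, l₀ k + h n k ∈ domain (ν k) (T k) := fun n k => by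
    rw [← domain_add_flat (ha n k), ← hl_eq]
    exact hl n k
  have hAeq : ∀ k, ∀ v ∈ domain (ν k) (T k), ∀ b ∈ flat (ν k) (T k),
      logPartition (ν k) (T k) (v + b) =
        logPartition (ν k) (T k) v + mean (ν k) (T k) (l₀ k) b := by
    rintro k v hv b ⟨c, hc⟩
    rw [(add_flat hc hv).2, mean_apply_flat (hT k) (h₀ k) hc]
  set g : ℕ → κ → ℝ := fun n k => logPartition (ν k) (T k) (l₀ k + h n k) -
    logPartition (ν k) (T k) (l₀ k) - mean (ν k) (T k) (l₀ k) (h n k)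
  have hg0 : ∀ n k, 0 ≤ g n k := fun n k => by
    have := bregman_nonneg (hT k) (h₀ k) (hdom n k)
    rw [add_sub_cancel_left] at this
    simp only [g]
    linarith
  have hgsum : ∀ n, ∑ k, g n k ≤ (x n).2 - μ₀ (x n).1 +
      (μ₀ (G l₀) - ∑ k, logPartition (ν k) (T k) (l₀ k)) := fun n => by
    have e : ∑ k, g n k = ∑ k, logPartition (ν k) (T k) (l n k) - μ₀ (G (l n)) +
        (μ₀ (G l₀) - ∑ k, logPartition (ν k) (T k) (l₀ k)) := by
      rw [← hμ, ← hμ, ← Finset.sum_sub_distrib, ← Finset.sum_sub_distrib,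
        ← Finset.sum_add_distrib]
      refine Finset.sum_congr rfl fun k _ => ?_
      simp only [g]
      rw [hl_eq n k, hAeq k _ (hdom n k) _ (ha n k), map_add, map_add]
      ring
    rw [e, hGl n]
    have := hA n
    linarith
  have hp1 : Filter.Tendsto (fun n => (x n).1) Filter.atTop (nhds p.1) :=
    (continuous_fst.tendsto p).comp hp
  have hp2 : Filter.Tendsto (fun n => (x n).2) Filter.atTop (nhds p.2) :=
    (continuous_snd.tendsto p).comp hp
  have hlim := (hp2.sub ((μ₀.continuous.tendsto _).comp hp1)).add_const
    (μ₀ (G l₀) - ∑ k, logPartition (ν k) (T k) (l₀ k))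
  obtain ⟨B, hB⟩ := hlim.bddAbove_range
  have hgB : ∀ n k, g n k ≤ B := fun n k =>
    (Finset.single_le_sum (fun j _ => hg0 n j) (Finset.mem_univ k)).trans
      ((hgsum n).trans (hB ⟨n, rfl⟩))
  have hhB : ∀ n k, ‖h n k‖ ≤ 1 + |B| / η k := fun n k => by
    rcases le_or_gt 1 ‖h n k‖ with h1 | h1
    · have h2 := hco k (h n k) (hh n k) (hdom n k) h1
      have h3 : ‖h n k‖ ≤ |B| / η k := by
        rw [le_div_iff₀' (hη k)]
        exact h2.trans ((hgB n k).trans (le_abs_self B))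
      linarith
    · have : 0 ≤ |B| / η k := div_nonneg (abs_nonneg B) (hη k).le
      linarith
  -- Extract a limit of the transversal displacements and of their Bregman divergences.
  have hbdd : Bornology.IsBounded
      (Metric.closedBall (0 : ∀ k, E k) (1 + ∑ k, |B| / η k) ×ˢ
        Metric.closedBall (0 : κ → ℝ) |B|) :=
    Metric.isBounded_closedBall.prod Metric.isBounded_closedBall
  have hs0 : ∀ k, 0 ≤ |B| / η k := fun k => div_nonneg (abs_nonneg B) (hη k).le
  obtain ⟨⟨h', g'⟩, -, φ, hφ, hconv⟩ := tendsto_subseq_of_bounded hbdd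
    (x := fun n => (h n, g n)) fun n => by
      refine ⟨?_, ?_⟩
      · rw [mem_closedBall_zero_iff, pi_norm_le_iff_of_nonneg
          (add_nonneg zero_le_one (Finset.sum_nonneg fun k _ => hs0 k))]
        exact fun k => (hhB n k).trans (add_le_add le_rfl
          (Finset.single_le_sum (fun j _ => hs0 j) (Finset.mem_univ k)))
      · rw [mem_closedBall_zero_iff, pi_norm_le_iff_of_nonneg (abs_nonneg B)]
        intro k
        rw [Real.norm_of_nonneg (hg0 n k)]
        exact (hgB n k).trans (le_abs_self B)
  have hconv_h : Filter.Tendsto (fun n => h (φ n)) Filter.atTop (nhds h') :=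
    (continuous_fst.tendsto _).comp hconv
  have hconv_g : Filter.Tendsto (fun n => g (φ n)) Filter.atTop (nhds g') :=
    (continuous_snd.tendsto _).comp hconv
  have hk_h := fun k => tendsto_pi_nhds.1 hconv_h k
  have hk_g := fun k => tendsto_pi_nhds.1 hconv_g k
  have hlimit : ∀ k, l₀ k + h' k ∈ domain (ν k) (T k) ∧
      logPartition (ν k) (T k) (l₀ k + h' k) ≤
        g' k + logPartition (ν k) (T k) (l₀ k) + mean (ν k) (T k) (l₀ k) (h' k) := fun k => by
    refine logPartition_le_of_tendsto (measurable_apply (hT k)) (fun n => hdom (φ n) k)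
      (s := fun n => g (φ n) k + logPartition (ν k) (T k) (l₀ k) +
        mean (ν k) (T k) (l₀ k) (h (φ n) k)) (fun n => ?_) ((hk_h k).const_add _)
      (((hk_g k).add_const _).add (((mean (ν k) (T k) (l₀ k)).continuous.tendsto _).comp (hk_h k)))
    simp only [g]
    linarith
  have hsumg : ∑ k, g' k ≤ p.2 - μ₀ p.1 +
      (μ₀ (G l₀) - ∑ k, logPartition (ν k) (T k) (l₀ k)) :=
    le_of_tendsto_of_tendsto' (tendsto_finsetSum _ fun k _ => hk_g k)
      (hlim.comp hφ.tendsto_atTop) fun n => hgsum (φ n)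
  have hmem : p.1 - G (l₀ + h') ∈ N.map G := by
    refine (N.map G).closed_of_finiteDimensional.mem_of_tendsto
      ((hp1.comp hφ.tendsto_atTop).sub ((hGc.tendsto _).comp (hconv_h.const_add l₀)))
      (Filter.Eventually.of_forall fun n => ⟨a (φ n), fun k _ => ha (φ n) k, ?_⟩)
    simp only [Function.comp_apply]
    rw [← hGl (φ n), ← map_sub]
    congr 1
    ext1 k
    simp [hl_eq (φ n) k]
  obtain ⟨a', ha', hGa⟩ := hmem
  have hGtot : G (l₀ + h' + a') = p.1 := by rw [map_add, hGa]; abel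
  refine ⟨l₀ + h' + a', fun k => (domain_add_flat (ha' k (mem_univ k))).2 (hlimit k).1, hGtot, ?_⟩
  have hfin : ∑ k, logPartition (ν k) (T k) ((l₀ + h' + a') k) ≤
      ∑ k, g' k + ∑ k, logPartition (ν k) (T k) (l₀ k) + (μ₀ (G (l₀ + h' + a')) - μ₀ (G l₀)) := by
    rw [← hμ, ← hμ, ← Finset.sum_sub_distrib, ← Finset.sum_add_distrib, ← Finset.sum_add_distrib]
    refine Finset.sum_le_sum fun k _ => ?_
    have h1 := (hlimit k).2
    have h2 := hAeq k _ (hlimit k).1 _ (ha' k (mem_univ k))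
    simp only [Pi.add_apply, map_add] at h1 h2 ⊢
    linarith
  rw [hGtot] at hfin
  linarith

/-- Strong duality: every finite dual bound on the infimal convolution is attained by a feasible
point. -/
theorem mem_convEpigraph_of_dual_bound [FiniteDimensional ℝ W] [∀ k, NeZero (ν k)]
    (hT : ∀ k, Measurable (T k)) (h₀ : ∀ k, l₀ k ∈ interior (domain (ν k) (T k)))
    (hμ : ∀ l, ∑ k, mean (ν k) (T k) (l₀ k) (l k) = μ₀ (G l)) {ξ : W} {s : ℝ}
    (hbound : ∀ (μ : StrongDual ℝ W) (B : ℝ), (∀ l, (∀ k, l k ∈ domain (ν k) (T k)) →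
      μ (G l) - ∑ k, logPartition (ν k) (T k) (l k) ≤ B) → μ ξ - s ≤ B) :
    (ξ, s) ∈ convEpigraph ν T G := by
  by_contra hnot
  obtain ⟨f, u, hfx, hfC⟩ := geometric_hahn_banach_point_closed (convex_convEpigraph hT)
    (isClosed_convEpigraph hT h₀ hμ) hnot
  set f₁ : StrongDual ℝ W := f.comp (ContinuousLinearMap.inl ℝ W ℝ)
  set τ := f (0, 1)
  have hf : ∀ w r, f (w, r) = f₁ w + r * τ := fun w r => by
    have : ((w, r) : W × ℝ) = (w, 0) + r • (0, 1) := by simp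
    rw [this, map_add, map_smul]
    simp [f₁, τ]
  have hdomle : ∀ l, (∀ k, l k ∈ domain (ν k) (T k)) → ∀ r,
      ∑ k, logPartition (ν k) (T k) (l k) ≤ r → u < f₁ (G l) + r * τ := fun l hl r hr => by
    rw [← hf]
    exact hfC _ ⟨l, hl, rfl, hr⟩
  rw [hf] at hfx
  -- The second coordinate of the epigraph is unbounded above.
  have hτ : 0 ≤ τ := by
    by_contra hneg
    push Not at hneg
    set A := ∑ k, logPartition (ν k) (T k) (l₀ k)
    have := hdomle l₀ (fun k => interior_subset (h₀ k)) (A + |f₁ (G l₀) + A * τ - u| / (-τ))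
      (le_add_of_nonneg_right (div_nonneg (abs_nonneg _) (by linarith)))
    have e : |f₁ (G l₀) + A * τ - u| / (-τ) * τ = -|f₁ (G l₀) + A * τ - u| := by
      rw [div_neg, neg_mul, div_mul_cancel₀ _ hneg.ne]
    rw [add_mul, e] at this
    linarith [le_abs_self (f₁ (G l₀) + A * τ - u)]
  rcases hτ.eq_or_lt with h0 | hpos
  · -- A vertical hyperplane would make the dual value unbounded along `μ₀ - r f₁`.
    rw [← h0, mul_zero, add_zero] at hfx
    set B₀ := μ₀ (G l₀) - ∑ k, logPartition (ν k) (T k) (l₀ k)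
    have hr : ∀ r : ℝ, 0 ≤ r → μ₀ ξ - r * f₁ ξ - s ≤ B₀ - r * u := by
      intro r hr
      refine hbound (μ₀ - r • f₁) _ fun l hl => ?_
      have h1 := hdomle l hl _ le_rfl
      rw [← h0, mul_zero, add_zero] at h1
      have h2 := sub_sum_logPartition_le hT h₀ hμ hl
      have h3 := mul_le_mul_of_nonneg_left h1.le hr
      simp only [sub_apply, smul_apply, smul_eq_mul]
      linarith
    have hgap : 0 < u - f₁ ξ := by linarith
    have := hr ((|B₀ + s - μ₀ ξ| + 1) / (u - f₁ ξ)) (by positivity)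
    have e : (|B₀ + s - μ₀ ξ| + 1) / (u - f₁ ξ) * (u - f₁ ξ) = |B₀ + s - μ₀ ξ| + 1 :=
      div_mul_cancel₀ _ hgap.ne'
    linarith [le_abs_self (B₀ + s - μ₀ ξ)]
  · have h1 := hbound (-(τ⁻¹ • f₁)) (-(τ⁻¹ * u)) fun l hl => by
      have h2 := mul_le_mul_of_nonneg_left (hdomle l hl _ le_rfl).le (inv_nonneg.2 hτ)
      have e : ∀ r : ℝ, τ⁻¹ * (f₁ (G l) + r * τ) = τ⁻¹ * f₁ (G l) + r := fun r => by
        field_simp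
      rw [e] at h2
      simp only [neg_apply, smul_apply, smul_eq_mul]
      linarith
    have h2 := mul_lt_mul_of_pos_left hfx (inv_pos.2 hpos)
    have e : τ⁻¹ * (f₁ ξ + s * τ) = τ⁻¹ * f₁ ξ + s := by field_simp
    rw [e] at h2
    simp only [neg_apply, smul_apply, smul_eq_mul] at h1
    linarith

/-- The infimal convolution is attained wherever it is feasible. -/
theorem exists_isMinimal [FiniteDimensional ℝ W] [∀ k, NeZero (ν k)]
    (hT : ∀ k, Measurable (T k)) (h₀ : ∀ k, l₀ k ∈ interior (domain (ν k) (T k)))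
    (hμ : ∀ l, ∑ k, mean (ν k) (T k) (l₀ k) (l k) = μ₀ (G l)) {ξ : W} {s : ℝ}
    (hfeas : (ξ, s) ∈ convEpigraph ν T G) :
    ∃ l, (∀ k, l k ∈ domain (ν k) (T k)) ∧ G l = ξ ∧
      ∀ l', (∀ k, l' k ∈ domain (ν k) (T k)) → G l' = ξ →
        ∑ k, logPartition (ν k) (T k) (l k) ≤ ∑ k, logPartition (ν k) (T k) (l' k) := by
  have hcl : IsClosed {r : ℝ | (ξ, r) ∈ convEpigraph ν T G} :=
    (isClosed_convEpigraph hT h₀ hμ).preimage (by fun_prop : Continuous fun r : ℝ => (ξ, r))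
  have hbdd : BddBelow {r : ℝ | (ξ, r) ∈ convEpigraph ν T G} := by
    refine ⟨μ₀ ξ - (μ₀ (G l₀) - ∑ k, logPartition (ν k) (T k) (l₀ k)), ?_⟩
    rintro r ⟨l, hl, hG, hr⟩
    have := sub_sum_logPartition_le hT h₀ hμ hl
    simp only at hG hr
    rw [hG] at this
    linarith
  have hleast := hcl.isLeast_csInf ⟨s, hfeas⟩ hbdd
  obtain ⟨l, hl, hG, hA⟩ := hleast.1
  exact ⟨l, hl, hG, fun l' hl' hG' => hA.trans (hleast.2 ⟨l', hl', hG', le_rfl⟩)⟩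

end ExpFamily
end

/-! ### Stationary points of the EC Gibbs free energy -/

noncomputable section

namespace TreeModel

open ExpFamily

section Gather

variable {V F : Type*} [DecidableEq V] [Fintype F] (M : TreeModel V F)

/-- The sums `∑_{k ∈ ∂i} lam_{i → k}` of edge parameters over the factors at a variable. -/
def gather : M.FacParams →ₗ[ℝ] M.VarParams where
  toFun lamF i := ∑ k : {k : F // i ∈ M.nbr k}, lamF k ⟨i, k.2⟩
  map_add' a b := by
    ext1 i
    simp [Finset.sum_add_distrib]
  map_smul' r a := by
    ext1 i
    simp [Finset.smul_sum]

theorem gather_apply (lamF : M.FacParams) (i : V) :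
    M.gather lamF i = ∑ k : {k : F // i ∈ M.nbr k}, lamF k ⟨i, k.2⟩ := rfl

theorem naturalConstraint_iff {lamV : M.VarParams} {lamF : M.FacParams} :
    M.NaturalConstraint lamV lamF ↔ ∀ i, ((M.n i : ℝ) - 1) • lamV i = M.gather lamF i := Iff.rfl

/-- The collection of edge parameters supported on a single edge. -/
def singleEdge [DecidableEq F] (k : F) (i : M.nbr k) (w : M.P i) : M.FacParams :=
  Pi.single k (Pi.single i w)

theorem sum_inner_singleEdge [DecidableEq F] (m : M.FacParams) (k : F) (i : M.nbr k) (w : M.P i) :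
    ∑ k', ∑ i' : M.nbr k', inner ℝ (M.singleEdge k i w k' i') (m k' i') = inner ℝ w (m k i) := by
  rw [Finset.sum_eq_single k, Finset.sum_eq_single i]
  · simp [singleEdge]
  · intro j _ hj
    simp [singleEdge, Pi.single_eq_of_ne hj]
  · simp
  · intro j _ hj
    simp [singleEdge, Pi.single_eq_of_ne hj]
  · simp

theorem gather_singleEdge [DecidableEq F] (k : F) (i : M.nbr k) (w : M.P i) :
    M.gather (M.singleEdge k i w) = Pi.single (M := M.P) (i : V) w := by
  obtain ⟨i, hi⟩ := i
  ext1 j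
  rw [gather_apply]
  rcases eq_or_ne j i with rfl | hj
  · rw [Finset.sum_eq_single ⟨k, hi⟩]
    · simp [singleEdge]
    · rintro ⟨k', hk'⟩ _ hne
      have : k' ≠ k := fun h => hne (Subtype.ext h)
      simp [singleEdge, Pi.single_eq_of_ne this]
    · simp
  · rw [Pi.single_eq_of_ne hj]
    refine Finset.sum_eq_zero fun k' _ => ?_
    obtain ⟨k', hk'⟩ := k'
    rcases eq_or_ne k' k with rfl | hk
    · have : (⟨j, hk'⟩ : M.nbr k') ≠ ⟨i, hi⟩ := fun h => hj (Subtype.ext_iff.1 h)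
      simp [singleEdge, Pi.single_eq_of_ne this]
    · simp [singleEdge, Pi.single_eq_of_ne hk]

variable [Fintype V]

/-- Summation over the edges, grouped by factors or by variables. -/
theorem sum_edges {β : Type*} [AddCommMonoid β] (g : ∀ k, M.nbr k → β) :
    ∑ k, ∑ i : M.nbr k, g k i = ∑ i, ∑ k : {k : F // i ∈ M.nbr k}, g k ⟨i, k.2⟩ := by
  let e : (Σ k, M.nbr k) ≃ (Σ i, {k : F // i ∈ M.nbr k}) :=
    { toFun := fun p => ⟨p.2.1, p.1, p.2.2⟩
      invFun := fun p => ⟨p.2.1, p.1, p.2.2⟩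
      left_inv := fun _ => rfl
      right_inv := fun _ => rfl }
  rw [← Fintype.sum_sigma (fun p : Σ k, M.nbr k => g p.1 p.2),
    ← Fintype.sum_sigma (fun p : Σ i, {k : F // i ∈ M.nbr k} => g p.2 ⟨p.1, p.2.2⟩)]
  exact Fintype.sum_equiv e _ _ fun _ => rfl

theorem sum_edges_const (g : V → ℝ) :
    ∑ k, ∑ i : M.nbr k, g i = ∑ i, (M.n i : ℝ) * g i := by
  rw [M.sum_edges fun k i => g i]
  simp [n]

theorem sum_inner_eq_gather (lamF : M.FacParams) (m : M.VarParams) :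
    ∑ k, ∑ i : M.nbr k, inner ℝ (lamF k i) (m i) = ∑ i, inner ℝ (M.gather lamF i) (m i) := by
  rw [M.sum_edges fun k i => inner ℝ (lamF k i) (m i)]
  simp only [gather_apply, sum_inner]

theorem sum_piPair_restrict (lamF : M.FacParams) (m : M.VarParams) :
    ∑ k, piPair (fun i : M.nbr k => M.P i) (M.restrict m k) (lamF k) =
      piPair M.P m (M.gather lamF) := by
  simp only [piPair_apply, restrict]
  exact M.sum_inner_eq_gather lamF m

end Gather

theorem gibbsDomain_of_fixedPoint {V F : Type*} [DecidableEq V] [Fintype F] (M : TreeModel V F)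
    {lamV : M.VarParams} {lamF : M.FacParams}
    (h : M.IsEPFixedPoint lamV lamF) : (fun i => M.varMoment i (lamV i)) ∈ M.gibbsDomain := by
  obtain ⟨hV, hF, hmom, hnat⟩ := h
  intro k
  have : M.restrict (fun i => M.varMoment i (lamV i)) k = M.facMoment k (lamF k) := by
    ext1 i
    exact hmom k i
  rw [this, M.facGibbs_facMoment (hF k)]
  exact EReal.coe_ne_top _

variable {V F : Type*} [Fintype V] [DecidableEq V] [Fintype F] (M : TreeModel V F)

section GibbsFreeEnergy

/-- Since the variable terms enter with nonpositive coefficients, any natural parameters of the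
variables bound the EC Gibbs free energy from above. -/
theorem gibbsFreeEnergy_le [Nonempty F] {mu lamV : M.VarParams} {a : F → ℝ}
    (hF : ∀ k, M.facGibbs k (M.restrict mu k) = (a k : EReal))
    (hV : ∀ i, lamV i ∈ M.varDomain i) :
    M.gibbsFreeEnergy mu ≤ ((∑ k, a k + ∑ i, (1 - (M.n i : ℝ)) *
      (inner ℝ (lamV i) (mu i) - M.varLogPartition i (lamV i)) : ℝ) : EReal) := by
  rw [gibbsFreeEnergy, EReal.coe_add, EReal.coe_finsetSum, EReal.coe_finsetSum]
  refine add_le_add (Finset.sum_le_sum fun k _ => (hF k).le) (Finset.sum_le_sum fun i _ => ?_)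
  rw [EReal.coe_mul, mul_comm, mul_comm (((1 - (M.n i : ℝ)) : ℝ) : EReal)]
  refine EReal.mul_le_mul_of_nonpos_right ?_ ?_
  · exact le_iSup₂ (f := fun lam (_ : lam ∈ M.varDomain i) =>
      ((inner ℝ lam (mu i) - M.varLogPartition i lam : ℝ) : EReal)) (lamV i) (hV i)
  · rw [EReal.coe_nonpos, sub_nonpos]
    exact_mod_cast M.one_le_n i

/-- Along the natural-parameter constraint, the EC Gibbs free energy of the moments of an EP fixed
point is minus the EP free energy of its natural parameters. -/
theorem gibbsFreeEnergy_of_fixedPoint {mu lamV : M.VarParams} {lamF : M.FacParams}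
    (h : M.IsEPFixedPoint lamV lamF) (hmu : ∀ i, M.varMoment i (lamV i) = mu i) :
    M.gibbsFreeEnergy mu = ((-M.epFreeEnergy lamV lamF : ℝ) : EReal) := by
  obtain ⟨hV, hF, hmom, hnat⟩ := h
  have hres : ∀ k, M.facMoment k (lamF k) = M.restrict mu k := fun k => by
    ext1 i
    rw [← hmom k i, hmu i, restrict]
  rw [M.gibbsFreeEnergy_eq_coe (fun k => by rw [← hres k]; exact M.facGibbs_facMoment (hF k))
    (fun i _ => by rw [← hmu i]; exact M.varGibbs_varMoment (hV i))]
  congr 1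
  simp only [hres, hmu, Finset.sum_sub_distrib, mul_sub, epFreeEnergy]
  rw [M.sum_piPair_restrict, piPair_apply]
  have : ∀ i, inner ℝ (M.gather lamF i) (mu i) =
      -((1 - (M.n i : ℝ)) * inner ℝ (lamV i) (mu i)) := fun i => by
    rw [← M.naturalConstraint_iff.1 hnat i, inner_smul_left]
    simp only [map_sub, map_natCast, map_one]
    ring
  simp only [this, Finset.sum_neg_distrib]
  ring

/-- The derivative of the EC Gibbs free energy along a line in the directions in which the factor
moments can move. -/
theorem hasDerivAt_gibbsFreeEnergy {M : TreeModel V F} (hmin : M.VariableMinimal)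
    {mu lamV δ : M.VarParams}
    {lamF : M.FacParams} (hV : ∀ i, lamV i ∈ interior (M.varDomain i))
    (hmV : ∀ i, M.varMoment i (lamV i) = mu i) (hF : ∀ k, lamF k ∈ interior (M.facDomain k))
    (hmF : ∀ k, M.facMoment k (lamF k) = M.restrict mu k)
    (hδ : ∀ k, ∀ a ∈ flat (M.f k) (M.facStat k),
      piPair (fun i : M.nbr k => M.P i) (M.restrict δ k) a = 0) :
    (∀ᶠ t : ℝ in nhds 0, mu + t • δ ∈ M.gibbsDomain ∧ M.gibbsFreeEnergy (mu + t • δ) =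
      (((M.gibbsFreeEnergy (mu + t • δ)).toReal : ℝ) : EReal)) ∧
    HasDerivAt (fun t : ℝ => (M.gibbsFreeEnergy (mu + t • δ)).toReal)
      (piPair M.P δ (M.gather lamF) + ∑ i, (1 - (M.n i : ℝ)) * inner ℝ (lamV i) (δ i)) 0 := by
  have hV' : ∀ i, lamV i ∈ interior (domain volume (M.varStat i)) := fun i =>
    M.varDomain_eq i ▸ hV i
  have hF' : ∀ k, lamF k ∈ interior (domain (M.f k) (M.facStat k)) := fun k =>
    M.facDomain_eq k ▸ hF k
  have hδV : ∀ i, ∀ a ∈ flat volume (M.varStat i), innerPair (M.P i) (δ i) a = 0 := by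
    intro i a ha
    rw [flat_varStat hmin, Submodule.mem_bot] at ha
    rw [ha, map_zero]
  have eF : ∀ k (t : ℝ), M.facGibbs k (M.restrict (mu + t • δ) k) = legendre (M.f k) (M.facStat k)
      (mean (M.f k) (M.facStat k) (lamF k) +
        t • piPair (fun i : M.nbr k => M.P i) (M.restrict δ k)) := fun k t => by
    rw [facGibbs_eq, M.mean_facStat (hF k), hmF k, ← map_smul, ← map_add]
    rfl
  have eV : ∀ i (t : ℝ), M.varGibbs i ((mu + t • δ) i) = legendre volume (M.varStat i)
      (mean volume (M.varStat i) (lamV i) + t • innerPair (M.P i) (δ i)) := fun i t => by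
    rw [varGibbs_eq, mean_varStat, hmV i, ← map_smul, ← map_add]
    rfl
  have hdF := fun k => hasDerivAt_legendre (M.measurable_facStat k) (hF' k) (hδ k)
  have hdV := fun i => hasDerivAt_legendre (M.measurable_varStat i) (hV' i) (hδV i)
  have hd := (HasDerivAt.fun_sum fun k (_ : k ∈ Finset.univ) => hdF k).fun_add
    (HasDerivAt.fun_sum fun i (_ : i ∈ Finset.univ) => (hdV i).const_mul (1 - (M.n i : ℝ)))
  rw [M.sum_piPair_restrict] at hd
  simp only [innerPair_apply] at hd
  have hevF := Filter.eventually_all.2 fun k =>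
    eventually_legendre_ne_top (M.measurable_facStat k) (hF' k) (hδ k)
  have hevV := Filter.eventually_all.2 fun i =>
    eventually_legendre_ne_top (M.measurable_varStat i) (hV' i) (hδV i)
  have hval : ∀ᶠ t : ℝ in nhds 0, mu + t • δ ∈ M.gibbsDomain ∧ M.gibbsFreeEnergy (mu + t • δ) =
      ((∑ k, (legendre (M.f k) (M.facStat k) (mean (M.f k) (M.facStat k) (lamF k) +
        t • piPair (fun i : M.nbr k => M.P i) (M.restrict δ k))).toReal +
      ∑ i, (1 - (M.n i : ℝ)) * (legendre volume (M.varStat i)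
        (mean volume (M.varStat i) (lamV i) + t • innerPair (M.P i) (δ i))).toReal : ℝ) :
        EReal) := by
    filter_upwards [hevF, hevV] with t h1 h2
    refine ⟨fun k => by rw [eF]; exact h1 k, M.gibbsFreeEnergy_eq_coe (fun k => ?_) fun i _ => ?_⟩
    · rw [coe_toReal_legendre ⟨_, interior_subset (hF' k)⟩ (h1 k), eF]
    · rw [coe_toReal_legendre ⟨_, interior_subset (hV' i)⟩ (h2 i), eV]
  refine ⟨?_, hd.congr_of_eventuallyEq ?_⟩
  · filter_upwards [hval] with t ht
    exact ⟨ht.1, by rw [ht.2, EReal.toReal_coe]⟩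
  · filter_upwards [hval] with t ht
    rw [ht.2, EReal.toReal_coe]

/-- A regular point at which the EC Gibbs free energy has vanishing derivatives along lines in its
domain is the moment vector of an EP fixed point. The natural parameters of the factors are
determined only up to directions of constant energy; the first-order condition says that they can be
corrected along these directions so as to meet the natural-parameter constraint. -/
theorem exists_fixedPoint_of_deriv_eq_zero {M : TreeModel V F} (hmin : M.VariableMinimal)
    {mu : M.VarParams} (hmu : mu ∈ M.momentDomain)
    (h0 : ∀ δ : M.VarParams, (∀ᶠ t : ℝ in nhds 0, mu + t • δ ∈ M.gibbsDomain ∧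
      M.gibbsFreeEnergy (mu + t • δ) = (((M.gibbsFreeEnergy (mu + t • δ)).toReal : ℝ) : EReal)) →
      ∀ d, HasDerivAt (fun t : ℝ => (M.gibbsFreeEnergy (mu + t • δ)).toReal) d 0 → d = 0) :
    ∃ lamV lamF, M.IsEPFixedPoint lamV lamF ∧ ∀ i, M.varMoment i (lamV i) = mu i := by
  classical
  obtain ⟨hV, hF⟩ := hmu
  choose lamV hlV hmV using hV
  choose lamF hlF hmF using hF
  set N : Submodule ℝ M.FacParams := Submodule.pi univ fun k => flat (M.f k) (M.facStat k)
  have hmem : (M.gather lamF - fun i => ((M.n i : ℝ) - 1) • lamV i) ∈ N.map M.gather := by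
    by_contra hnot
    obtain ⟨f, hfr, hfN⟩ := Submodule.exists_le_ker_of_notMem hnot
    set δ : M.VarParams := (piPair M.P).symm (LinearMap.toContinuousLinearMap f)
    have hfδ : ∀ v, f v = piPair M.P δ v := fun v => by simp [δ]
    obtain ⟨h1, h2⟩ := hasDerivAt_gibbsFreeEnergy hmin (δ := δ) hlV hmV hlF hmF fun k a ha => by
      have h3 : M.gather (Pi.single k a) ∈ N.map M.gather := by
        refine Submodule.mem_map_of_mem fun j _ => ?_
        rcases eq_or_ne j k with rfl | hj
        · simpa using ha
        · simp [Pi.single_eq_of_ne hj]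
      have h4 : f (M.gather (Pi.single k a)) = 0 := hfN h3
      rw [hfδ, ← M.sum_piPair_restrict, Finset.sum_eq_single k] at h4
      · simpa only [Pi.single_eq_same] using h4
      · intro j _ hj
        rw [Pi.single_eq_of_ne hj, map_zero]
      · simp
    refine hfr ?_
    rw [hfδ, map_sub, ← h0 δ h1 _ h2]
    simp only [piPair_apply, inner_smul_left, sub_eq_add_neg, ← Finset.sum_neg_distrib]
    congr 1
    refine Finset.sum_congr rfl fun i _ => ?_
    simp only [map_add, map_natCast, map_neg, map_one]
    ring
  obtain ⟨a, ha, hga⟩ := hmem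
  have ha' : ∀ k, -a k ∈ flat (M.f k) (M.facStat k) := fun k =>
    Submodule.neg_mem _ (ha k (mem_univ k))
  have hint : ∀ k, (lamF - a) k ∈ interior (M.facDomain k) := fun k => by
    rw [Pi.sub_apply, sub_eq_add_neg, facDomain_eq]
    exact interior_domain_add_flat (ha' k) (M.facDomain_eq k ▸ hlF k)
  refine ⟨lamV, lamF - a, ⟨hlV, hint, fun k i => ?_, ?_⟩, hmV⟩
  · have h1 : M.facMoment k ((lamF - a) k) = M.facMoment k (lamF k) := by
      apply (piPair fun i : M.nbr k => M.P i).injective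
      rw [← M.mean_facStat (hint k), ← M.mean_facStat (hlF k), Pi.sub_apply, sub_eq_add_neg,
        mean_add_flat (ha' k)]
    rw [h1, hmF k, hmV i, restrict]
  · rw [naturalConstraint_iff]
    intro i
    rw [map_sub, hga]
    simp

theorem exists_fixedPoint_of_isGibbsStationary {M : TreeModel V F} (hmin : M.VariableMinimal)
    {mu : M.VarParams} (h : M.IsGibbsStationary mu) :
    ∃ lamV lamF, M.IsEPFixedPoint lamV lamF ∧ ∀ i, M.varMoment i (lamV i) = mu i := by
  refine exists_fixedPoint_of_deriv_eq_zero hmin h.1 fun δ hδ d hd => ?_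
  have h1 : HasDerivAt (fun t : ℝ => mu + t • δ) δ 0 := by
    simpa using ((hasDerivAt_id (0 : ℝ)).smul_const δ).const_add mu
  have h2 : HasFDerivWithinAt (fun m => (M.gibbsFreeEnergy m).toReal)
      (0 : M.VarParams →L[ℝ] ℝ) M.gibbsDomain (mu + (0 : ℝ) • δ) := by
    simpa using h.2
  have h3 := HasFDerivWithinAt.comp_hasDerivAt (0 : ℝ) h2 h1 (hδ.mono fun t ht => ht.1)
  rw [zero_apply] at h3
  exact hd.unique h3

theorem exists_fixedPoint_of_isGibbsMinimum {M : TreeModel V F} (hmin : M.VariableMinimal)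
    {mu : M.VarParams} {c : ℝ} (hmu : mu ∈ M.momentDomain)
    (hc : M.gibbsFreeEnergy mu = (c : EReal))
    (hle : ∀ mu' ∈ M.gibbsDomain, (c : EReal) ≤ M.gibbsFreeEnergy mu') :
    ∃ lamV lamF, M.IsEPFixedPoint lamV lamF ∧ ∀ i, M.varMoment i (lamV i) = mu i := by
  refine exists_fixedPoint_of_deriv_eq_zero hmin hmu fun δ hδ d hd => ?_
  refine IsLocalMin.hasDerivAt_eq_zero ?_ hd
  filter_upwards [hδ] with t ht
  have h1 := hle _ ht.1
  rw [ht.2, EReal.coe_le_coe_iff] at h1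
  simpa [hc] using h1

end GibbsFreeEnergy

end TreeModel
end

/-! ### The EP and Tree-AMP free energies -/

noncomputable section

namespace TreeModel

open ExpFamily

section LogPartition

variable {V F : Type*} (M : TreeModel V F)

theorem hasFDerivAt_varLogPartition {i : V} {lam : M.P i} (h : lam ∈ interior (M.varDomain i)) :
    HasFDerivAt (M.varLogPartition i) (innerPair (M.P i) (M.varMoment i lam)) lam := by
  rw [varLogPartition_eq, ← mean_varStat]
  exact hasFDerivAt_logPartition (M.measurable_varStat i) (M.varDomain_eq i ▸ h)

theorem hasFDerivAt_facLogPartition {k : F} {lam : M.PF k}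
    (h : lam ∈ interior (M.facDomain k)) : HasFDerivAt (M.facLogPartition k)
      (piPair (fun i : M.nbr k => M.P i) (M.facMoment k lam)) lam := by
  rw [facLogPartition_eq, ← M.mean_facStat h]
  exact hasFDerivAt_logPartition (M.measurable_facStat k) (M.facDomain_eq k ▸ h)

/-- By minimality, the mean map of a variable is injective. -/
theorem varMoment_injOn {M : TreeModel V F} (hmin : M.VariableMinimal) (i : V) :
    InjOn (M.varMoment i) (interior (M.varDomain i)) := by
  intro a ha b hb hab
  rw [varDomain_eq] at ha hb
  have h1 := sub_mem_flat_of_mean_eq (M.measurable_varStat i) hb ha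
    (by rw [mean_varStat, mean_varStat, hab])
  rwa [flat_varStat hmin, Submodule.mem_bot, sub_eq_zero] at h1

end LogPartition

variable {V F : Type*} [Fintype V] [DecidableEq V] [Fintype F] (M : TreeModel V F)

section EP

theorem exists_hasFDerivAt_epFreeEnergy {lamV : M.VarParams} {lamF : M.FacParams}
    (hV : ∀ i, lamV i ∈ interior (M.varDomain i)) (hF : ∀ k, lamF k ∈ interior (M.facDomain k)) :
    ∃ D : M.VarParams × M.FacParams →L[ℝ] ℝ,
      HasFDerivAt (fun q : M.VarParams × M.FacParams => M.epFreeEnergy q.1 q.2) D (lamV, lamF) ∧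
      ∀ v, D v = ∑ k, ∑ i : M.nbr k, inner ℝ (v.2 k i) (M.facMoment k (lamF k) i) +
        ∑ i, (1 - (M.n i : ℝ)) * inner ℝ (v.1 i) (M.varMoment i (lamV i)) := by
  let LF : ∀ k, M.VarParams × M.FacParams →L[ℝ] M.PF k := fun k =>
    (ContinuousLinearMap.proj k).comp (ContinuousLinearMap.snd ℝ M.VarParams M.FacParams)
  let LV : ∀ i, M.VarParams × M.FacParams →L[ℝ] M.P i := fun i =>
    (ContinuousLinearMap.proj i).comp (ContinuousLinearMap.fst ℝ M.VarParams M.FacParams)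
  have h1 : ∀ k, HasFDerivAt (fun q => M.facLogPartition k (LF k q))
      ((piPair (fun i : M.nbr k => M.P i) (M.facMoment k (lamF k))).comp (LF k)) (lamV, lamF) :=
    fun k => HasFDerivAt.comp (lamV, lamF) (g := M.facLogPartition k)
      (M.hasFDerivAt_facLogPartition (hF k)) (LF k).hasFDerivAt
  have h2 : ∀ i, HasFDerivAt (fun q => M.varLogPartition i (LV i q))
      ((innerPair (M.P i) (M.varMoment i (lamV i))).comp (LV i)) (lamV, lamF) :=
    fun i => HasFDerivAt.comp (lamV, lamF) (g := M.varLogPartition i)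
      (M.hasFDerivAt_varLogPartition (hV i)) (LV i).hasFDerivAt
  refine ⟨_, (HasFDerivAt.fun_sum fun k (_ : k ∈ Finset.univ) => h1 k).fun_add
    (HasFDerivAt.fun_sum fun i (_ : i ∈ Finset.univ) => (h2 i).const_mul (1 - (M.n i : ℝ))),
    fun v => ?_⟩
  simp [LF, LV]

/-- Stationary points of the EP free energy match the moments wherever the variable parameters
matter. -/
theorem exists_moments_of_isEPStationary [Nonempty F] {lamV : M.VarParams} {lamF : M.FacParams}
    (h : M.IsEPStationary lamV lamF) :
    ∃ mu : M.VarParams, (∀ k, ∀ i : M.nbr k, M.facMoment k (lamF k) i = mu i) ∧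
        ∀ i, M.n i ≠ 1 → M.varMoment i (lamV i) = mu i := by
  classical
  obtain ⟨hV, hF, hnat, hst⟩ := h
  obtain ⟨D, hD, hDv⟩ := M.exists_hasFDerivAt_epFreeEnergy hV hF
  have hD0 : ∀ v : M.VarParams × M.FacParams, M.NaturalConstraint v.1 v.2 → D v = 0 := by
    intro v hv
    have h1 : HasDerivAt (fun t : ℝ => (lamV, lamF) + t • v) v 0 := by
      simpa using ((hasDerivAt_id (0 : ℝ)).smul_const v).const_add (lamV, lamF)
    have h2 : HasFDerivAt (fun q : M.VarParams × M.FacParams => M.epFreeEnergy q.1 q.2) D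
        ((lamV, lamF) + (0 : ℝ) • v) := by simpa using hD
    have h3 : HasFDerivWithinAt (fun q : M.VarParams × M.FacParams => M.epFreeEnergy q.1 q.2)
        (0 : M.VarParams × M.FacParams →L[ℝ] ℝ) {q | M.NaturalConstraint q.1 q.2}
        ((lamV, lamF) + (0 : ℝ) • v) := by simpa using hst
    have h4 := HasFDerivWithinAt.comp_hasDerivAt (0 : ℝ) h3 h1
      (Filter.Eventually.of_forall fun t => by
        rw [naturalConstraint_iff] at hnat hv
        refine M.naturalConstraint_iff.2 fun i => ?_
        simp only [Prod.fst_add, Prod.snd_add, Prod.smul_fst, Prod.smul_snd, map_add, map_smul,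
          Pi.add_apply, Pi.smul_apply, smul_add, hnat i, ← hv i]
        rw [smul_comm])
    exact (h2.comp_hasDerivAt (0 : ℝ) h1).unique h4
  have hmatch : ∀ k, ∀ i : M.nbr k, M.n i ≠ 1 →
      M.facMoment k (lamF k) i = M.varMoment i (lamV i) := by
    intro k i hi
    have hc : ((M.n i : ℝ) - 1) ≠ 0 := sub_ne_zero.2 fun h => hi (by exact_mod_cast h)
    refine ext_inner_left ℝ fun w => ?_
    -- A variation of the parameter of the variable, compensated on a single edge.
    have h1 := hD0 (Pi.single (M := M.P) (i : V) w, ((M.n i : ℝ) - 1) • M.singleEdge k i w) (by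
      refine M.naturalConstraint_iff.2 fun j => ?_
      simp only [map_smul, Pi.smul_apply, gather_singleEdge]
      rcases eq_or_ne j i with rfl | hj
      · rfl
      · simp [Pi.single_eq_of_ne hj])
    rw [hDv] at h1
    simp only [Pi.smul_apply, inner_smul_left, ← Finset.mul_sum] at h1
    rw [M.sum_inner_singleEdge, Finset.sum_eq_single (i : V)
      (fun j _ hj => by simp [Pi.single_eq_of_ne hj]) (by simp), Pi.single_eq_same] at h1
    simp only [map_sub, map_natCast, map_one] at h1
    have h2 : ((M.n i : ℝ) - 1) * (inner ℝ w (M.facMoment k (lamF k) i) -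
        inner ℝ w (M.varMoment i (lamV i))) = 0 := by linarith
    exact sub_eq_zero.1 ((mul_eq_zero.1 h2).resolve_left hc)
  have hex : ∀ i, Nonempty {k : F // i ∈ M.nbr k} := fun i =>
    Fintype.card_pos_iff.1 (M.one_le_n i)
  let k₀ : ∀ i, {k : F // i ∈ M.nbr k} := fun i => (hex i).some
  refine ⟨fun i => M.facMoment (k₀ i) (lamF (k₀ i)) ⟨i, (k₀ i).2⟩, fun k i => ?_, fun i hi =>
    (hmatch (k₀ i) ⟨i, (k₀ i).2⟩ hi).symm⟩
  beta_reduce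
  by_cases hi : M.n i = 1
  · have hsub : (⟨k, i.2⟩ : {k : F // (i : V) ∈ M.nbr k}) = k₀ i :=
      Fintype.card_le_one_iff.1 hi.le _ _
    rw [← hsub]
  · rw [hmatch k i hi, hmatch (k₀ i) ⟨i, (k₀ i).2⟩ hi]

end EP

section TreeAMP

theorem exists_hasFDerivAt_treeAMPFreeEnergy {lamE : M.Messages}
    (hF : ∀ k, M.msgFac lamE k ∈ interior (M.facDomain k))
    (hE : ∀ k, ∀ i : M.nbr k, M.msgEdge lamE k i ∈ interior (M.varDomain i))
    (hV : ∀ i, M.msgVar lamE i ∈ interior (M.varDomain i)) :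
    ∃ D : M.Messages →L[ℝ] ℝ, HasFDerivAt M.treeAMPFreeEnergy D lamE ∧
      ∀ v, D v = ∑ k, ∑ i : M.nbr k, inner ℝ (v.2 k i) (M.facMoment k (M.msgFac lamE k) i) -
        ∑ k, ∑ i : M.nbr k, inner ℝ (v.2 k i + v.1 k i) (M.varMoment i (M.msgEdge lamE k i)) +
        ∑ i, inner ℝ (M.gather v.1 i) (M.varMoment i (M.msgVar lamE i)) := by
  let LF : ∀ k, M.Messages →L[ℝ] M.PF k := fun k =>
    (ContinuousLinearMap.proj k).comp (ContinuousLinearMap.snd ℝ M.FacParams M.FacParams)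
  let LF' : ∀ k, M.Messages →L[ℝ] M.PF k := fun k =>
    (ContinuousLinearMap.proj k).comp (ContinuousLinearMap.fst ℝ M.FacParams M.FacParams)
  let LE : ∀ k, ∀ i : M.nbr k, M.Messages →L[ℝ] M.P i := fun k i =>
    (ContinuousLinearMap.proj i).comp (LF k) + (ContinuousLinearMap.proj i).comp (LF' k)
  let LV : ∀ i, M.Messages →L[ℝ] M.P i := fun i =>
    ∑ k : {k : F // i ∈ M.nbr k},
      (ContinuousLinearMap.proj (R := ℝ) (φ := fun j : M.nbr k.1 => M.P j)
        (⟨i, k.2⟩ : M.nbr k.1)).comp (LF' k.1)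
  have eV : ∀ i (q : M.Messages), LV i q = M.msgVar q i := fun i q => by
    simp [LV, LF', msgVar]
  have h1 : ∀ k, HasFDerivAt (fun q => M.facLogPartition k (M.msgFac q k))
      ((piPair (fun i : M.nbr k => M.P i) (M.facMoment k (M.msgFac lamE k))).comp (LF k)) lamE :=
    fun k => HasFDerivAt.comp lamE (g := M.facLogPartition k) (f := fun q => M.msgFac q k)
      (M.hasFDerivAt_facLogPartition (hF k)) (LF k).hasFDerivAt
  have h2 : ∀ k, ∀ i : M.nbr k, HasFDerivAt (fun q => M.varLogPartition i (M.msgEdge q k i))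
      ((innerPair (M.P i) (M.varMoment i (M.msgEdge lamE k i))).comp (LE k i)) lamE :=
    fun k i => HasFDerivAt.comp lamE (g := M.varLogPartition i) (f := fun q => M.msgEdge q k i)
      (M.hasFDerivAt_varLogPartition (hE k i)) (LE k i).hasFDerivAt
  have h3 : ∀ i, HasFDerivAt (fun q => M.varLogPartition i (M.msgVar q i))
      ((innerPair (M.P i) (M.varMoment i (M.msgVar lamE i))).comp (LV i)) lamE := by
    intro i
    have h4 : HasFDerivAt (fun q => M.msgVar q i) (LV i) lamE := by
      rw [show (fun q => M.msgVar q i) = LV i from funext fun q => (eV i q).symm]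
      exact (LV i).hasFDerivAt
    exact HasFDerivAt.comp lamE (g := M.varLogPartition i) (f := fun q => M.msgVar q i)
      (M.hasFDerivAt_varLogPartition (hV i)) h4
  refine ⟨_, ((HasFDerivAt.fun_sum fun k (_ : k ∈ Finset.univ) => h1 k).fun_sub
    (HasFDerivAt.fun_sum fun k (_ : k ∈ Finset.univ) =>
      HasFDerivAt.fun_sum fun i (_ : i ∈ Finset.univ) => h2 k i)).fun_add
    (HasFDerivAt.fun_sum fun i (_ : i ∈ Finset.univ) => h3 i), fun v => ?_⟩
  have eV' : ∀ i, LV i v = M.gather v.1 i := fun i => eV i v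
  simp only [add_apply, sub_apply, sum_apply, ContinuousLinearMap.comp_apply, piPair_apply,
    innerPair_apply, eV']
  rfl

/-- Stationary points of the Tree-AMP free energy are EP fixed points at which the edge parameters
`lam_i^k` agree with `lam_i`. -/
theorem fixedPoint_of_isTreeAMPStationary {M : TreeModel V F} (hmin : M.VariableMinimal)
    {lamE : M.Messages} (h : M.IsTreeAMPStationary lamE) :
    M.IsEPFixedPoint (M.msgVar lamE) (M.msgFac lamE) ∧
      ∀ k, ∀ i : M.nbr k, M.msgEdge lamE k i = M.msgVar lamE i := by
  classical
  obtain ⟨hF, hE, hV, hst⟩ := h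
  obtain ⟨D, hD, hDv⟩ := M.exists_hasFDerivAt_treeAMPFreeEnergy hF hE hV
  have hD0 : ∀ v, D v = 0 := fun v => by rw [hD.unique hst, zero_apply]
  have hvar : ∀ k, ∀ i : M.nbr k,
      M.varMoment i (M.msgEdge lamE k i) = M.varMoment i (M.msgVar lamE i) := by
    intro k i
    refine ext_inner_left ℝ fun w => ?_
    have h1 := hD0 (M.singleEdge k i w, 0)
    rw [hDv] at h1
    simp only [Pi.zero_apply, inner_zero_left, Finset.sum_const_zero, zero_add, zero_sub] at h1
    rw [M.sum_inner_singleEdge (fun k i => M.varMoment i (M.msgEdge lamE k i)),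
      gather_singleEdge, Finset.sum_eq_single (i : V)
      (fun j _ hj => by simp [Pi.single_eq_of_ne hj]) (by simp), Pi.single_eq_same] at h1
    linarith
  have hfac : ∀ k, ∀ i : M.nbr k,
      M.facMoment k (M.msgFac lamE k) i = M.varMoment i (M.msgEdge lamE k i) := by
    intro k i
    refine ext_inner_left ℝ fun w => ?_
    have h1 := hD0 (0, M.singleEdge k i w)
    rw [hDv] at h1
    simp only [map_zero, Pi.zero_apply, inner_zero_left, Finset.sum_const_zero, add_zero] at h1
    rw [M.sum_inner_singleEdge, M.sum_inner_singleEdge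
      (fun k i => M.varMoment i (M.msgEdge lamE k i))] at h1
    linarith
  have hedge : ∀ k, ∀ i : M.nbr k, M.msgEdge lamE k i = M.msgVar lamE i := fun k i =>
    varMoment_injOn hmin i (hE k i) (hV i) (hvar k i)
  refine ⟨⟨hV, hF, fun k i => by rw [hfac, hvar], fun i => ?_⟩, hedge⟩
  have h1 : ∑ k : {k : F // i ∈ M.nbr k}, M.msgEdge lamE k ⟨i, k.2⟩ =
      (M.n i : ℝ) • M.msgVar lamE i := by
    rw [Finset.sum_congr rfl (g := fun _ => M.msgVar lamE i) fun k _ => hedge k.1 ⟨i, k.2⟩,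
      Finset.sum_const, Finset.card_univ,
      ← Nat.cast_smul_eq_nsmul ℝ]
    rfl
  simp only [msgEdge, Finset.sum_add_distrib] at h1
  rw [sub_smul, one_smul, ← h1]
  exact add_sub_cancel_right _ _

/-- When the edge parameters agree with those of the variables, the Tree-AMP free energy is the EP free
energy. -/
theorem treeAMPFreeEnergy_eq {lamE : M.Messages}
    (h : ∀ k, ∀ i : M.nbr k, M.msgEdge lamE k i = M.msgVar lamE i) :
    M.treeAMPFreeEnergy lamE = M.epFreeEnergy (M.msgVar lamE) (M.msgFac lamE) := by
  simp only [treeAMPFreeEnergy, epFreeEnergy, h]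
  rw [M.sum_edges_const fun i => M.varLogPartition i (M.msgVar lamE i)]
  simp only [sub_mul, one_mul, Finset.sum_sub_distrib]
  ring

/-- Every EP fixed point comes from a stationary point of the Tree-AMP free energy, with messages
`lam_{k → i} = lam_i - lam_{i → k}`. -/
theorem exists_isTreeAMPStationary {lamV : M.VarParams} {lamF : M.FacParams}
    (h : M.IsEPFixedPoint lamV lamF) :
    ∃ lamE, M.IsTreeAMPStationary lamE ∧ M.msgVar lamE = lamV ∧ M.msgFac lamE = lamF := by
  obtain ⟨hV, hF, hmom, hnat⟩ := h
  let lamE : M.Messages := (fun k i => lamV i - lamF k i, lamF)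
  have hfac : M.msgFac lamE = lamF := rfl
  have hedge : ∀ k, ∀ i : M.nbr k, M.msgEdge lamE k i = lamV i := fun k i =>
    add_sub_cancel _ _
  have hvar : M.msgVar lamE = lamV := by
    ext1 i
    change ∑ k : {k : F // i ∈ M.nbr k}, (lamV i - lamF k ⟨i, k.2⟩) = lamV i
    rw [Finset.sum_sub_distrib, ← hnat i, Finset.sum_const, Finset.card_univ,
      ← Nat.cast_smul_eq_nsmul ℝ]
    change (M.n i : ℝ) • lamV i - _ = _
    module
  obtain ⟨D, hD, hDv⟩ := M.exists_hasFDerivAt_treeAMPFreeEnergy (lamE := lamE)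
    (by rwa [hfac]) (fun k i => by rw [hedge]; exact hV i) (by rwa [hvar])
  have hD0 : D = 0 := by
    refine ContinuousLinearMap.ext fun v => ?_
    rw [hDv, zero_apply]
    simp only [hfac, hedge, hvar, ← hmom, inner_add_left, Finset.sum_add_distrib]
    rw [M.sum_inner_eq_gather v.1 fun i => M.varMoment i (lamV i)]
    ring
  exact ⟨lamE, ⟨by rwa [hfac], fun k i => by rw [hedge]; exact hV i, by rwa [hvar], hD0 ▸ hD⟩,
    hvar, hfac⟩

end TreeAMP

section Duality

variable {M}

/-- The hypothesis of strong duality: moments that agree across the factors are a functional of the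
sums of the edge parameters. -/
theorem sum_mean_facStat {mu : M.VarParams} {lamF : M.FacParams}
    (hF : ∀ k, lamF k ∈ interior (M.facDomain k))
    (hm : ∀ k, M.facMoment k (lamF k) = M.restrict mu k) (l : M.FacParams) :
    ∑ k, mean (M.f k) (M.facStat k) (lamF k) (l k) = piPair M.P mu (M.gather l) := by
  rw [← M.sum_piPair_restrict]
  exact Finset.sum_congr rfl fun k _ => by rw [M.mean_facStat (hF k), hm k]

/-- A lower bound on the EC Gibbs free energy is dominated, for all natural parameters of the
variables, by minus the EP free energy at feasible natural parameters of the factors. -/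
theorem exists_feasible_of_le_gibbs [Nonempty F] {mu : M.VarParams} (hmu : mu ∈ M.momentDomain)
    {c : ℝ} (hle : ∀ mu' ∈ M.gibbsDomain, (c : EReal) ≤ M.gibbsFreeEnergy mu')
    {lamV : M.VarParams} (hV : ∀ i, lamV i ∈ M.varDomain i) :
    ∃ lamF ∈ M.epFeasible lamV, (c ≤ -M.epFreeEnergy lamV lamF) ∧
      ∀ lamF' ∈ M.epFeasible lamV,
        -M.epFreeEnergy lamV lamF' ≤ -M.epFreeEnergy lamV lamF := by
  obtain ⟨-, hF⟩ := hmu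
  choose lamF₀ hF₀ hmF using hF
  have hF₀' : ∀ k, lamF₀ k ∈ interior (domain (M.f k) (M.facStat k)) := fun k =>
    M.facDomain_eq k ▸ hF₀ k
  set ξ : M.VarParams := fun i => ((M.n i : ℝ) - 1) • lamV i
  set s : ℝ := ∑ i, ((M.n i : ℝ) - 1) * M.varLogPartition i (lamV i) - c
  have hfeas : (ξ, s) ∈ convEpigraph M.f M.facStat M.gather := by
    refine mem_convEpigraph_of_dual_bound M.measurable_facStat hF₀' (sum_mean_facStat hF₀ hmF)
      fun μ B hB => ?_
    obtain ⟨m, rfl⟩ := (piPair M.P).surjective μ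
    obtain ⟨a, ha, haB⟩ := exists_legendre_eq_of_sum_le (ν := M.f) (T := M.facStat)
      (m := fun k => piPair (fun i : M.nbr k => M.P i) (M.restrict m k)) (B := B)
      (fun k => ⟨_, interior_subset (hF₀' k)⟩) fun l hl => by
        have h1 := hB l hl
        rw [← M.sum_piPair_restrict] at h1
        rwa [Finset.sum_sub_distrib]
    have ha' : ∀ k, M.facGibbs k (M.restrict m k) = (a k : EReal) := fun k => by
      rw [facGibbs_eq, ha k]
    have h1 := (hle m fun k => by rw [ha' k]; exact EReal.coe_ne_top _).trans
      (M.gibbsFreeEnergy_le ha' hV)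
    rw [EReal.coe_le_coe_iff] at h1
    have h2 : piPair M.P m ξ = -∑ i, (1 - (M.n i : ℝ)) * inner ℝ (lamV i) (m i) := by
      rw [piPair_apply, ← Finset.sum_neg_distrib]
      refine Finset.sum_congr rfl fun i _ => ?_
      simp only [ξ, inner_smul_left, map_sub, map_natCast, map_one]
      ring
    have h3 : ∑ i, ((M.n i : ℝ) - 1) * M.varLogPartition i (lamV i) =
        -∑ i, (1 - (M.n i : ℝ)) * M.varLogPartition i (lamV i) := by
      rw [← Finset.sum_neg_distrib]
      exact Finset.sum_congr rfl fun i _ => by ring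
    simp only [mul_sub, Finset.sum_sub_distrib] at h1
    simp only [s]
    rw [h2, h3]
    linarith
  obtain ⟨lamF, hd, hG, hmin⟩ := exists_isMinimal M.measurable_facStat hF₀'
    (sum_mean_facStat hF₀ hmF) hfeas
  have hep : ∀ l : M.FacParams, M.epFreeEnergy lamV l =
      ∑ k, logPartition (M.f k) (M.facStat k) (l k) + (-s - c) := fun l => by
    have h3 : ∑ i, (1 - (M.n i : ℝ)) * M.varLogPartition i (lamV i) =
        -∑ i, ((M.n i : ℝ) - 1) * M.varLogPartition i (lamV i) := by
      rw [← Finset.sum_neg_distrib]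
      exact Finset.sum_congr rfl fun i _ => by ring
    simp only [epFreeEnergy, facLogPartition_eq, h3, s]
    ring
  refine ⟨lamF, ⟨fun k => by rw [facDomain_eq]; exact hd k,
    M.naturalConstraint_iff.2 fun i => (congrFun hG i).symm⟩, ?_, ?_⟩
  · obtain ⟨l, hl, hGl, hsl⟩ := hfeas
    have := (hmin l hl hGl).trans hsl
    rw [hep]
    simp only at this
    linarith
  · rintro lamF' ⟨hd', hnat'⟩
    rw [hep, hep]
    have := hmin lamF' (fun k => by rw [← facDomain_eq]; exact hd' k)
      (funext fun i => (M.naturalConstraint_iff.1 hnat' i).symm)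
    linarith

/-- At an EP fixed point, the natural parameters of the factors maximize minus the EP free energy. -/
theorem neg_epFreeEnergy_le_of_fixedPoint {lamV : M.VarParams} {lamF lamF' : M.FacParams}
    (h : M.IsEPFixedPoint lamV lamF) (h' : lamF' ∈ M.epFeasible lamV) :
    -M.epFreeEnergy lamV lamF' ≤ -M.epFreeEnergy lamV lamF := by
  obtain ⟨hV, hF, hmom, hnat⟩ := h
  have hm : ∀ k, M.facMoment k (lamF k) = M.restrict (fun i => M.varMoment i (lamV i)) k :=
    fun k => by
      ext1 i
      exact (hmom k i).symm
  have h1 := sub_sum_logPartition_le (G := M.gather) M.measurable_facStat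
    (fun k => M.facDomain_eq k ▸ hF k)
    (sum_mean_facStat hF hm) (l := lamF') fun k => M.facDomain_eq k ▸ h'.1 k
  have hG : M.gather lamF' = M.gather lamF := by
    ext1 i
    rw [← M.naturalConstraint_iff.1 hnat i, ← M.naturalConstraint_iff.1 h'.2 i]
  rw [hG] at h1
  simp only [epFreeEnergy, facLogPartition_eq]
  linarith

end Duality

section OptimalValue

variable {M}

theorem isLeast_relaxedBetheValues {c : ℝ} (h : M.IsGibbsMinimum c) :
    IsLeast M.relaxedBetheValues c := by
  obtain ⟨mu, hmu, hc, hle⟩ := h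
  constructor
  · obtain ⟨b, hb⟩ := M.exists_isBetheStationaryAt hmu
    refine ⟨mu, b, hb, ?_⟩
    have := M.betheFreeEnergy_eq_gibbs hb
    rw [hc] at this
    exact EReal.coe_injective this
  · rintro v ⟨mu', b, hb, rfl⟩
    have h1 := hle mu' fun k => by
      rw [(M.gibbs_eq_of_stationary hb).1 k]
      exact EReal.coe_ne_top _
    rw [← M.betheFreeEnergy_eq_gibbs hb] at h1
    exact EReal.coe_le_coe_iff.1 h1

theorem isLeast_epMaxValues [Nonempty F] (hmin : M.VariableMinimal) {c : ℝ}
    (h : M.IsGibbsMinimum c) : IsLeast M.epMaxValues c := by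
  obtain ⟨mu, hmu, hc, hle⟩ := h
  constructor
  · obtain ⟨lamV, lamF, hfix, hm⟩ := exists_fixedPoint_of_isGibbsMinimum hmin hmu hc hle
    have h1 := M.gibbsFreeEnergy_of_fixedPoint hfix hm
    rw [hc] at h1
    refine ⟨lamV, fun i => interior_subset (hfix.1 i), ⟨lamF,
      ⟨fun k => interior_subset (hfix.2.1 k), hfix.2.2.2⟩, (EReal.coe_injective h1).symm⟩, ?_⟩
    rintro _ ⟨lamF', hF', rfl⟩
    rw [EReal.coe_injective h1]
    exact neg_epFreeEnergy_le_of_fixedPoint hfix hF'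
  · rintro v ⟨lamV, hV, -, hub⟩
    obtain ⟨lamF, hF, hcF, -⟩ := exists_feasible_of_le_gibbs hmu hle hV
    exact hcF.trans (hub ⟨lamF, hF, rfl⟩)

theorem gibbsFreeEnergy_msgMoment (hmin : M.VariableMinimal) {lamE : M.Messages}
    (h : M.IsTreeAMPStationary lamE) :
    M.msgMoment lamE ∈ M.gibbsDomain ∧
      M.gibbsFreeEnergy (M.msgMoment lamE) = ((-M.treeAMPFreeEnergy lamE : ℝ) : EReal) := by
  obtain ⟨hfix, hedge⟩ := fixedPoint_of_isTreeAMPStationary hmin h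
  refine ⟨M.gibbsDomain_of_fixedPoint hfix, ?_⟩
  rw [M.treeAMPFreeEnergy_eq hedge]
  exact M.gibbsFreeEnergy_of_fixedPoint hfix fun i => rfl

theorem isMinExtr_iff (hmin : M.VariableMinimal) {c : ℝ} (h : M.IsGibbsMinimum c) (v : ℝ) :
    M.IsMinExtr v ↔ v = c := by
  obtain ⟨mu, hmu, hc, hle⟩ := h
  obtain ⟨lamV, lamF, hfix, hm⟩ := exists_fixedPoint_of_isGibbsMinimum hmin hmu hc hle
  obtain ⟨lamE, hst, hEV, hEF⟩ := M.exists_isTreeAMPStationary hfix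
  have hmom : M.msgMoment lamE = mu := by
    ext1 i
    rw [msgMoment, hEV, hm]
  constructor
  · rintro ⟨lamE', hst', hmin', rfl⟩
    obtain ⟨hdom, hG⟩ := gibbsFreeEnergy_msgMoment hmin hst'
    have h1 := hle _ hdom
    have h2 := hmin' lamE hst
    rw [hG] at h1 h2
    rw [hmom, hc] at h2
    exact le_antisymm (EReal.coe_le_coe_iff.1 h2) (EReal.coe_le_coe_iff.1 h1)
  · rintro rfl
    have hG := (gibbsFreeEnergy_msgMoment hmin hst).2
    refine ⟨lamE, hst, fun lamE' hst' => ?_, ?_⟩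
    · rw [hmom, hc]
      exact hle _ (gibbsFreeEnergy_msgMoment hmin hst').1
    · rw [hmom, hc] at hG
      exact EReal.coe_injective hG

end OptimalValue

end TreeModel
end

theorem proposition1 {V F : Type*} [Fintype V] [DecidableEq V] [Fintype F] [Nonempty F]
    (M : TreeModel V F) (hmin : M.VariableMinimal) :
    -- at fixed moments, the relaxed Bethe problem is solved with value `G[mu_V]`
    (∀ mu ∈ M.momentDomain, ∃ b, M.IsBetheStationaryAt mu b) ∧
    (∀ mu b, M.IsBetheStationaryAt mu b →
      (M.betheFreeEnergy b : EReal) = M.gibbsFreeEnergy mu ∧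
      ∀ b' : M.Beliefs, b'.Admissible → b'.HasMoments mu →
        M.betheFreeEnergy b ≤ M.betheFreeEnergy ⟨b.pV, b'.pF⟩ ∧
        M.betheFreeEnergy ⟨b'.pV, b.pF⟩ ≤ M.betheFreeEnergy b) ∧
    -- the equivalent forms of the optimal value
    (∀ c : ℝ, M.IsGibbsMinimum c →
      IsLeast M.relaxedBetheValues c ∧
      (∀ lamV : M.VarParams, (∀ i, lamV i ∈ M.varDomain i) →
        ∃ lamF ∈ M.epFeasible lamV, ∀ lamF' ∈ M.epFeasible lamV,
          - M.epFreeEnergy lamV lamF' ≤ - M.epFreeEnergy lamV lamF) ∧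
      IsLeast M.epMaxValues c ∧
      (∀ v : ℝ, M.IsMinExtr v ↔ v = c)) ∧
    -- stationary points are EP fixed points
    (∀ mu, M.IsGibbsStationary mu →
      ∃ lamV lamF, M.IsEPFixedPoint lamV lamF ∧ ∀ i, M.varMoment i (lamV i) = mu i) ∧
    (∀ lamV lamF, M.IsEPStationary lamV lamF →
      M.NaturalConstraint lamV lamF ∧
      ∃ mu : M.VarParams, (∀ k, ∀ i : M.nbr k, M.facMoment k (lamF k) i = mu i) ∧
        ∀ i, M.n i ≠ 1 → M.varMoment i (lamV i) = mu i) ∧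
    (∀ lamE, M.IsTreeAMPStationary lamE →
      M.IsEPFixedPoint (M.msgVar lamE) (M.msgFac lamE)) := by 
  refine ⟨fun mu hmu => M.exists_isBetheStationaryAt hmu, fun mu b h =>
    ⟨M.betheFreeEnergy_eq_gibbs h, fun b' hb' hmom => M.bethe_saddle h hb' hmom⟩, fun c hc => ?_,
    fun mu h => TreeModel.exists_fixedPoint_of_isGibbsStationary hmin h,
    fun lamV lamF h => ⟨h.2.2.1, M.exists_moments_of_isEPStationary h⟩,
    fun lamE h => (TreeModel.fixedPoint_of_isTreeAMPStationary hmin h).1⟩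
  refine ⟨TreeModel.isLeast_relaxedBetheValues hc, fun lamV hV => ?_,
    TreeModel.isLeast_epMaxValues hmin hc, TreeModel.isMinExtr_iff hmin hc⟩
  obtain ⟨mu, hmu, -, hle⟩ := hc
  obtain ⟨lamF, hF, -, hmax⟩ := TreeModel.exists_feasible_of_le_gibbs hmu hle hV
  exact ⟨lamF, hF, hmax⟩
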